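/- Let $k$ be a field of characteristic $0$, let $X$ be a smooth scheme over $k$ with tangent sheaf $T_X$ (the sheaf of $k$-derivations of $\mathcal O_X$), and let $D$ be a sheaf of twisted differential operators (TDO) on $X$. That is, $D$ is a sheaf of associative $k$-algebras with an exhaustive multiplicative filtration $D^0\subset D^1\subset\cdots$ by subsheaves, and with an isomorphism of sheaves of graded $k$-algebras $\operatorname{gr} D\cong \operatorname{Sym}_{\mathcal O_X} T_X$ which, in degree $1$, sends the class of $\partial\in D^1$ to the derivation $f\mapsto \partial f-f\partial$ of $\mathcal O_X$ (that is, it is an isomorphism of Poisson algebras). Here $\mathcal O_X$ is regarded as a subsheaf of $D$ through the degree $0$ part $\mathcal O_X\cong D^0$ of the isomorphism. Let $P$ be $D$ or the opposite algebra $D^{op}$, viewed as an $\mathcal O_X$-bimodule. For $n\ge 0$ let $\mathrm{Diff}(\mathcal O_X^n,P)$ be the sheaf whose sections over an open set $U$ are the $k$-polylinear maps of sheaves $A:\mathcal O_U\times\cdots\times\mathcal O_U\to P|_U$ of $n$ arguments which are polydifferential operators: every point of $U$ has a neighbourhood on which, for some integers $N_1,\dots,N_n\ge 0$, $A$ is a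 differential operator of order at most $N_j$ in its $j$-th argument whenever the other arguments are fixed. (A map $\varphi:\mathcal O\to P$ has order at most $N$ if $\varphi_N=0$ for all functions $f_0,\dots,f_N$ on all smaller open sets, where $\varphi_{-1}=\varphi$ and $\varphi_m(s)=f_m\varphi_{m-1}(s)-\varphi_{m-1}(f_ms)$.) In particular $\mathrm{Diff}(\mathcal O_X^0,P)=P$. Put $$dA(g_1,\dots,g_{n+1})=g_1A(g_2,\dots,g_{n+1})+\sum_{j=1}^{n}(-1)^jA(g_1,\dots,g_jg_{j+1},\dots,g_{n+1})+(-1)^{n+1}A(g_1,\dots,g_n)g_{n+1}.$$ Then $\mathrm{Diff}(\mathcal O_X^\bullet,P)$ with the differential $d$ is a complex of sheaves, and the homomorphism $\mathcal O_X\to P=\mathrm{Diff}(\mathcal O_X^0,P)$ is a quasi-isomorphism from $\mathcal O_X$, placed in degree $0$, to $\mathrm{Diff}(\mathcal O_X^\bullet,P)$. More precisely, for $P=D$ the zeroth cohomology sheaf is the centralizer of $\mathcal O_X$ in $D$, and this is the subalgebra $\mathcal O_X\subset D$; all cohomology sheaves in positive degrees vanish. The same holds for $\mathrm{Diff}(\mathcal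 O_X^\bullet,D^{op})^{op}$, whose zeroth cohomology, a subalgebra of $(D^{op})^{op}=D$, is again the centralizer of $\mathcal O_X$ in $D$. -/

import Mathlib

open CategoryTheory Opposite TopologicalSpace AlgebraicGeometry

universe u

noncomputable section

namespace TwistedDiff

section Constants

variable (k : Type u) [Field k] (X : Scheme.{u}) [X.Over (Spec (.of k))]

/-- The constants: for a scheme `X` over `k`, the structure map `k → 𝒪_X(U)`. -/
def constants (U : X.Opens) : k →+* Γ(X, U) :=
  ((Scheme.ΓSpecIso (.of k)).inv ≫ (X ↘ Spec (.of k)).appTop ≫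
    X.presheaf.map (homOfLE (le_top : U ≤ ⊤)).op).hom

instance sectionsAlgebra (U : X.Opens) : Algebra k Γ(X, U) := (constants k X U).toAlgebra

instance stalkAlgebra (x : X) : Algebra k (X.presheaf.stalk x) :=
  ((X.presheaf.germ ⊤ x trivial).hom.comp (constants k X ⊤)).toAlgebra

end Constants

/-- The functor `R ↦ Rᵐᵒᵖ` on rings. -/
def opRing : RingCat.{u} ⥤ RingCat.{u} where
  obj R := RingCat.of (R : Type u)ᵐᵒᵖ
  map f := RingCat.ofHom f.hom.op

/-- Restriction of regular functions. -/
def fres {X : Scheme.{u}} {V W : X.Opens} (h : W ≤ V) : Γ(X, V) →+* Γ(X, W) :=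
  (X.presheaf.map (homOfLE h).op).hom

/-- A sheaf `P` of associative `k`-algebras on the `k`-scheme `X` together with a homomorphism of
sheaves of `k`-algebras `𝒪_X → P`. The image of `𝒪_X` is not required to be central,
so `P` is an `𝒪_X`-bimodule by left and right multiplication; the constants are central. -/
structure AlgebraSheaf (k : Type u) [Field k] (X : Scheme.{u}) [X.Over (Spec (.of k))] where
  /-- the underlying sheaf of rings -/
  sheaf : TopCat.Sheaf RingCat.{u} X
  /-- the homomorphism from the structure sheaf -/
  unit : X.ringCatSheaf ⟶ sheaf
  constants_comm : ∀ (U : X.Opens) (c : k) (p : sheaf.obj.obj (op U)),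
    Commute ((unit.hom.app (op U)).hom (constants k X U c)) p

section Basic

variable {k : Type u} [Field k] {X : Scheme.{u}} [X.Over (Spec (.of k))]

namespace AlgebraSheaf

variable (P : AlgebraSheaf k X)

/-- Sections of `P` over `U`. -/
abbrev sec (U : X.Opens) : Type u := P.sheaf.obj.obj (op U)

/-- Restriction of sections of `P`. -/
def res {V W : X.Opens} (h : W ≤ V) : P.sec V →+* P.sec W :=
  (P.sheaf.obj.map (homOfLE h).op).hom

/-- The homomorphism `𝒪_X → P` on sections over `U`. -/
def ι (U : X.Opens) : Γ(X, U) →+* P.sec U := (P.unit.hom.app (op U)).hom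

instance secAlgebra (U : X.Opens) : Algebra k (P.sec U) :=
  ((P.ι U).comp (constants k X U)).toAlgebra' fun c p => P.constants_comm U c p

theorem res_ι {V W : X.Opens} (h : W ≤ V) (f : Γ(X, V)) :
    P.res h (P.ι V f) = P.ι W (fres h f) :=
  (congrArg (fun φ => φ.hom f) (P.unit.hom.naturality (homOfLE h).op)).symm

theorem ι_smul {V : X.Opens} (c : k) (f : Γ(X, V)) : P.ι V (c • f) = c • P.ι V f := by
  rw [Algebra.smul_def, map_mul, Algebra.smul_def]
  rfl

/-- The sheaf of opposite algebras `P^op`, with the same homomorphism from `𝒪_X`. As an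
`𝒪_X`-bimodule it is `P` with left and right actions exchanged. -/
protected def op : AlgebraSheaf k X where
  sheaf := ⟨P.sheaf.obj ⋙ opRing, by
    have h := (TopCat.Presheaf.isSheaf_iff_isSheaf_comp (forget RingCat.{u}) _).1 P.sheaf.property
    refine (TopCat.Presheaf.isSheaf_iff_isSheaf_comp (forget RingCat.{u}) _).2
      (TopCat.Presheaf.isSheaf_of_iso (NatIso.ofComponents (fun U =>
        (MulOpposite.opEquiv (α := P.sheaf.obj.obj U)).toIso) ?_) h)
    intro U V f
    rfl⟩
  unit := ⟨{
    app := fun U => RingCat.ofHom ((P.ι U.unop).toOpposite fun f g => by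
      rw [commute_iff_eq, ← map_mul, ← map_mul, mul_comm])
    naturality := fun U V f => by
      ext s
      exact congrArg MulOpposite.op (P.res_ι (leOfHom f.unop) s).symm }⟩
  constants_comm := fun U c p => by
    exact (P.constants_comm U c (MulOpposite.unop (α := P.sec U) p)).op

/-- Sections of `P^op` are sections of `P` with the opposite multiplication. -/
def opSec (U : X.Opens) : (P.sec U)ᵐᵒᵖ ≃+* P.op.sec U := RingEquiv.refl _

theorem op_ι (U : X.Opens) (f : Γ(X, U)) :
    P.op.ι U f = P.opSec U (MulOpposite.op (P.ι U f)) := rfl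

/-- The centralizer of `𝒪_X` in `P`: the sections over `U` which, on every smaller open
set, commute with all regular functions. -/
def centralizer (U : X.Opens) : Subring (P.sec U) :=
  ⨅ (V : X.Opens) (h : V ≤ U), (Subring.centralizer (Set.range (P.ι V))).comap (P.res h)

/-- `P`-valued `k`-polylinear maps `𝒪_X × ⋯ × 𝒪_X → P` of `n` arguments over `U`, as maps of
sheaves on `U`. -/
@[ext]
structure PolyMap (U : X.Opens) (n : ℕ) where
  /-- the polylinear map on sections over `V ≤ U` -/
  map : ∀ V : X.Opens, V ≤ U → MultilinearMap k (fun _ : Fin n => Γ(X, V)) (P.sec V)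
  map_res : ∀ (V W : X.Opens) (hV : V ≤ U) (hW : W ≤ V) (g : Fin n → Γ(X, V)),
    P.res hW (map V hV g) = map W (hW.trans hV) (fun i => fres hW (g i))

namespace PolyMap

variable {P} {U : X.Opens} {n : ℕ}

theorem map_injective : Function.Injective
    (fun (A : P.PolyMap U n) (V : {V : X.Opens // V ≤ U}) => A.map V.1 V.2) := fun _ _ h =>
  PolyMap.ext (funext fun V => funext fun hV => congrFun h ⟨V, hV⟩)

instance : Zero (P.PolyMap U n) := ⟨⟨fun _ _ => 0, fun _ _ _ _ _ => map_zero _⟩⟩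

instance : Add (P.PolyMap U n) :=
  ⟨fun A B => ⟨fun V hV => A.map V hV + B.map V hV, fun V W _ hW g => by
    simp [A.map_res, B.map_res]⟩⟩

instance : Neg (P.PolyMap U n) :=
  ⟨fun A => ⟨fun V hV => -A.map V hV, fun V W _ hW g => by simp [A.map_res]⟩⟩

instance : Sub (P.PolyMap U n) :=
  ⟨fun A B => ⟨fun V hV => A.map V hV - B.map V hV, fun V W _ hW g => by
    simp [A.map_res, B.map_res]⟩⟩

instance : SMul ℕ (P.PolyMap U n) :=
  ⟨fun m A => ⟨fun V hV => m • A.map V hV, fun V W _ hW g => by simp [A.map_res]⟩⟩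

instance : SMul ℤ (P.PolyMap U n) :=
  ⟨fun m A => ⟨fun V hV => m • A.map V hV, fun V W _ hW g => by simp [A.map_res]⟩⟩

instance : AddCommGroup (P.PolyMap U n) :=
  map_injective.addCommGroup _ rfl (fun _ _ => rfl) (fun _ => rfl) (fun _ _ => rfl)
    (fun _ _ => rfl) (fun _ _ => rfl)

/-- Evaluation at functions on `V`, as a homomorphism. -/
def eval (V : X.Opens) (hV : V ≤ U) (g : Fin n → Γ(X, V)) : P.PolyMap U n →+ P.sec V where
  toFun A := A.map V hV g
  map_zero' := rfl
  map_add' _ _ := rfl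

/-- Restriction of polylinear maps to a smaller open set. -/
def restrict (A : P.PolyMap U n) {V : X.Opens} (h : V ≤ U) : P.PolyMap V n where
  map W hW := A.map W (hW.trans h)
  map_res W W' _ hW' g := A.map_res W W' _ hW' g

/-- Polylinear maps of `0` arguments are sections of `P`. -/
def ofSection (U : X.Opens) : P.sec U ≃ P.PolyMap U 0 where
  toFun p :=
    { map := fun _ hV => MultilinearMap.constOfIsEmpty k _ (P.res hV p)
      map_res := fun V W hV hW _ => by
        change P.res hW (P.res hV p) = P.res _ p
        exact congrArg (fun φ => φ.hom p)
          (P.sheaf.obj.map_comp (homOfLE hV).op (homOfLE hW).op).symm }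
  invFun A := A.map U le_rfl Fin.elim0
  left_inv p := by
    change P.res le_rfl p = p
    exact congrArg (fun φ => φ.hom p) (P.sheaf.obj.map_id (op U))
  right_inv A := by
    ext V hV g
    change P.res hV (A.map U le_rfl Fin.elim0) = _
    rw [A.map_res]
    congr 1
    exact Subsingleton.elim _ _

end PolyMap

section Differential

theorem exists_contractNth_update {n : ℕ} {V : X.Opens} (j : Fin n) (g : Fin (n + 1) → Γ(X, V))
    (i : Fin (n + 1)) : ∃ (m : Fin n) (L : Γ(X, V) →ₗ[k] Γ(X, V)), ∀ x,
      Fin.contractNth j.castSucc (· * ·) (Function.update g i x) =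
        Function.update (Fin.contractNth j.castSucc (· * ·) g) m (L x) := by
  rcases lt_trichotomy (i : ℕ) j with h | h | h
  · refine ⟨⟨i, by omega⟩, LinearMap.id, fun x => ?_⟩
    ext l
    simp only [Fin.contractNth, Function.update_apply, Fin.ext_iff, LinearMap.id_apply]
    grind
  · refine ⟨j, LinearMap.mulRight k (g j.succ), fun x => ?_⟩
    ext l
    by_cases hl : l = j
    · subst hl
      have : i = l.castSucc := Fin.ext h
      subst this
      simp [Fin.contractNth, Fin.ext_iff]
    · have : (l : ℕ) ≠ j := fun h => hl (Fin.ext h)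
      simp only [Fin.contractNth, Function.update_apply, Fin.ext_iff]
      grind
  · by_cases h' : (i : ℕ) = j + 1
    · refine ⟨j, LinearMap.mulLeft k (g j.castSucc), fun x => ?_⟩
      ext l
      by_cases hl : l = j
      · subst hl
        have : i = l.succ := Fin.ext h'
        subst this
        simp [Fin.contractNth, Fin.ext_iff]
      · have : (l : ℕ) ≠ j := fun h => hl (Fin.ext h)
        simp only [Fin.contractNth, Function.update_apply, Fin.ext_iff]
        grind
    · refine ⟨⟨i - 1, by omega⟩, LinearMap.id, fun x => ?_⟩
      ext l
      simp only [Fin.contractNth, Function.update_apply, Fin.ext_iff, LinearMap.id_apply]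
      grind

variable {P} {U : X.Opens} {n : ℕ}

/-- `(g₁, …, gₙ₊₁) ↦ g₁ A(g₂, …, gₙ₊₁)` -/
def PolyMap.faceLeft (A : P.PolyMap U n) : P.PolyMap U (n + 1) where
  map V hV :=
    { toFun := fun g => P.ι V (g 0) * A.map V hV (Fin.tail g)
      map_update_add' := fun {inst} g i x y => by
        obtain rfl := Subsingleton.elim inst (instDecidableEqFin _)
        induction i using Fin.cases with
        | zero => simp [Fin.tail_update_zero, add_mul]
        | succ i =>
          simp [Fin.tail_update_succ, mul_add, Function.update_of_ne (Fin.succ_ne_zero i).symm]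
      map_update_smul' := fun {inst} g i c x => by
        obtain rfl := Subsingleton.elim inst (instDecidableEqFin _)
        induction i using Fin.cases with
        | zero => simp [Fin.tail_update_zero, P.ι_smul]
        | succ i => simp [Fin.tail_update_succ, Function.update_of_ne (Fin.succ_ne_zero i).symm] }
  map_res V W hV hW g := by
    change P.res hW (P.ι V (g 0) * A.map V hV (Fin.tail g)) = P.ι W _ * A.map W _ _
    rw [map_mul, A.map_res, P.res_ι]
    rfl

/-- `(g₁, …, gₙ₊₁) ↦ A(g₁, …, gⱼ gⱼ₊₁, …, gₙ₊₁)`; the index `j` is counted from `0`. -/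
def PolyMap.faceMid (j : Fin n) (A : P.PolyMap U n) : P.PolyMap U (n + 1) where
  map V hV :=
    { toFun := fun g => A.map V hV (Fin.contractNth j.castSucc (· * ·) g)
      map_update_add' := fun {inst} g i x y => by
        obtain rfl := Subsingleton.elim inst (instDecidableEqFin _)
        obtain ⟨m, L, h⟩ := exists_contractNth_update (k := k) j g i
        simp only [h, map_add, MultilinearMap.map_update_add]
      map_update_smul' := fun {inst} g i c x => by
        obtain rfl := Subsingleton.elim inst (instDecidableEqFin _)
        obtain ⟨m, L, h⟩ := exists_contractNth_update (k := k) j g i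
        simp only [h, map_smul, MultilinearMap.map_update_smul] }
  map_res V W hV hW g := by
    change P.res hW (A.map V hV _) = A.map W _ _
    rw [A.map_res]
    exact congrArg _ (Fin.comp_contractNth _ _ (map_mul (fres hW)) _ _)

/-- `(g₁, …, gₙ₊₁) ↦ A(g₁, …, gₙ) gₙ₊₁` -/
def PolyMap.faceRight (A : P.PolyMap U n) : P.PolyMap U (n + 1) where
  map V hV :=
    { toFun := fun g => A.map V hV (Fin.init g) * P.ι V (g (Fin.last n))
      map_update_add' := fun {inst} g i x y => by
        obtain rfl := Subsingleton.elim inst (instDecidableEqFin _)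
        induction i using Fin.lastCases with
        | last => simp [Fin.init_update_last, mul_add]
        | cast i => simp [Fin.init_update_castSucc, add_mul, i.castSucc_lt_last.ne']
      map_update_smul' := fun {inst} g i c x => by
        obtain rfl := Subsingleton.elim inst (instDecidableEqFin _)
        induction i using Fin.lastCases with
        | last => simp [Fin.init_update_last, P.ι_smul]
        | cast i => simp [Fin.init_update_castSucc, i.castSucc_lt_last.ne'] }
  map_res V W hV hW g := by
    change P.res hW (A.map V hV (Fin.init g) * P.ι V (g (Fin.last n))) =
      A.map W _ _ * P.ι W _
    rw [map_mul, A.map_res, P.res_ι]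
    rfl

/-- The differential
`dA(g₁, …, gₙ₊₁) = g₁ A(g₂, …, gₙ₊₁) + ∑ⱼ (-1)ʲ A(g₁, …, gⱼ gⱼ₊₁, …, gₙ₊₁)
  + (-1)ⁿ⁺¹ A(g₁, …, gₙ) gₙ₊₁`. -/
def PolyMap.d (A : P.PolyMap U n) : P.PolyMap U (n + 1) :=
  A.faceLeft + ∑ j : Fin n, (-1 : ℤ) ^ (j.1 + 1) • A.faceMid j + (-1 : ℤ) ^ (n + 1) • A.faceRight

theorem PolyMap.d_map (A : P.PolyMap U n) (V : X.Opens) (hV : V ≤ U) (g : Fin (n + 1) → Γ(X, V)) :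
    A.d.map V hV g = P.ι V (g 0) * A.map V hV (Fin.tail g) +
      ∑ j : Fin n, (-1 : ℤ) ^ (j.1 + 1) • A.map V hV (Fin.contractNth j.castSucc (· * ·) g) +
      (-1 : ℤ) ^ (n + 1) • (A.map V hV (Fin.init g) * P.ι V (g (Fin.last n))) := by
  change PolyMap.eval V hV g A.d = _
  rw [PolyMap.d, map_add, map_add, map_sum, map_zsmul]
  simp only [map_zsmul]
  rfl

end Differential

section Order

variable {P} {U : X.Opens} {n : ℕ}

variable (P) in
/-- For `φ : 𝒪_X(V) → P(V)` and functions `f₀, f₁, …`, the iterated commutators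
`φ₋₁ = φ`, `φₘ = fₘ φₘ₋₁ - φₘ₋₁ fₘ`, where `(f φ)(s) = f φ(s)` and `(φ f)(s) = φ(f s)`. -/
def iterComm {V : X.Opens} (fs : List Γ(X, V)) (φ : Γ(X, V) → P.sec V) : Γ(X, V) → P.sec V :=
  fs.foldl (fun φ f => fun s => P.ι V f * φ s - φ (f * s)) φ

theorem iterComm_zero {V : X.Opens} (fs : List Γ(X, V)) : P.iterComm fs 0 = 0 := by
  induction fs with
  | nil => rfl
  | cons f fs ih =>
    change P.iterComm fs (fun s => P.ι V f * 0 - 0) = 0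
    simp only [mul_zero, sub_zero]
    exact ih

theorem iterComm_add {V : X.Opens} (fs : List Γ(X, V)) (φ ψ : Γ(X, V) → P.sec V) :
    P.iterComm fs (φ + ψ) = P.iterComm fs φ + P.iterComm fs ψ := by
  induction fs generalizing φ ψ with
  | nil => rfl
  | cons f fs ih =>
    refine Eq.trans ?_ (ih _ _)
    change P.iterComm fs _ = _
    congr 1
    ext s
    simp only [Pi.add_apply, mul_add]
    abel

theorem iterComm_neg {V : X.Opens} (fs : List Γ(X, V)) (φ : Γ(X, V) → P.sec V) :
    P.iterComm fs (-φ) = -P.iterComm fs φ := by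
  rw [eq_neg_iff_add_eq_zero, ← iterComm_add, neg_add_cancel, iterComm_zero]

/-- `A` is, in its `j`-th argument, a differential operator of order at most `N j`, whenever the
remaining arguments are fixed, for each `j`. -/
def PolyMap.HasOrderLE (A : P.PolyMap U n) (N : Fin n → ℕ) : Prop :=
  ∀ (V : X.Opens) (hV : V ≤ U) (j : Fin n) (g : Fin n → Γ(X, V)) (fs : List Γ(X, V)),
    fs.length = N j + 1 → P.iterComm fs (fun s => A.map V hV (Function.update g j s)) = 0

theorem PolyMap.HasOrderLE.mono {A : P.PolyMap U n} {N M : Fin n → ℕ} (h : A.HasOrderLE N)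
    (hNM : N ≤ M) : A.HasOrderLE M := by
  intro V hV j g fs hfs
  have hj := hNM j
  have h1 := h V hV j g (fs.take (N j + 1)) (by
    rw [List.length_take, min_eq_left]
    change N j ≤ M j at hj
    omega)
  rw [← List.take_append_drop (N j + 1) fs, iterComm, List.foldl_append]
  refine Eq.trans ?_ (iterComm_zero (P := P) (fs.drop (N j + 1)))
  exact congrArg (P.iterComm (fs.drop (N j + 1))) h1

/-- `A` is a polydifferential operator: locally on `U` it is of bounded polyorder. -/
def PolyMap.IsPolyDiff (A : P.PolyMap U n) : Prop :=
  ∀ x ∈ U, ∃ (V : X.Opens) (hV : V ≤ U), x ∈ V ∧ ∃ N, (A.restrict hV).HasOrderLE N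

variable (P U n) in
/-- The sections over `U` of `Diff(𝒪_X^n, P)`: polydifferential operators of `n` arguments. -/
def Diff : AddSubgroup (P.PolyMap U n) where
  carrier := {A | A.IsPolyDiff}
  zero_mem' := fun x hx => ⟨U, le_rfl, hx, 0, fun _ _ _ _ fs _ => iterComm_zero fs⟩
  add_mem' {A B} hA hB := fun x hx => by
    obtain ⟨V, hV, hxV, N, hN⟩ := hA x hx
    obtain ⟨W, hW, hxW, M, hM⟩ := hB x hx
    refine ⟨V ⊓ W, inf_le_left.trans hV, ⟨hxV, hxW⟩, N ⊔ M, fun V' hV' j g fs hfs => ?_⟩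
    have h1 := hN.mono (le_sup_left (b := M)) V' (hV'.trans inf_le_left) j g fs hfs
    have h2 := hM.mono (le_sup_right (a := N)) V' (hV'.trans inf_le_right) j g fs hfs
    refine (iterComm_add fs _ _).trans ?_
    exact (congrArg₂ (· + ·) h1 h2).trans (add_zero _)
  neg_mem' {A} hA := fun x hx => by
    obtain ⟨V, hV, hxV, N, hN⟩ := hA x hx
    refine ⟨V, hV, hxV, N, fun V' hV' j g fs hfs => ?_⟩
    refine (iterComm_neg fs _).trans ?_
    exact (congrArg Neg.neg (hN V' hV' j g fs hfs)).trans neg_zero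

end Order

section Cohomology

/-- Sections over `U` of the zeroth cohomology sheaf of `Diff(𝒪_X^•, P)`: the kernel of the
differential on `Diff(𝒪_X^0, P) = P`. -/
def H0 (U : X.Opens) : Set (P.sec U) := {p | (PolyMap.ofSection (P := P) U p).d = 0}

/-- `Diff(𝒪_X^•, P)` with the differential `d` is a complex. -/
structure IsComplex : Prop where
  d_mem : ∀ (U : X.Opens) (n : ℕ), ∀ A ∈ P.Diff U n, A.d ∈ P.Diff U (n + 1)
  d_add : ∀ (U : X.Opens) (n : ℕ), ∀ A ∈ P.Diff U n, ∀ B ∈ P.Diff U n, (A + B).d = A.d + B.d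
  d_d : ∀ (U : X.Opens) (n : ℕ), ∀ A ∈ P.Diff U n, A.d.d = 0

/-- The cohomology sheaf of `Diff(𝒪_X^•, P)` in degree `n + 1` vanishes: every cocycle over an
open set is locally a coboundary. -/
def CohomologySheafVanishes (n : ℕ) : Prop :=
  ∀ (U : X.Opens), ∀ A ∈ P.Diff U (n + 1), A.d = 0 → ∀ x ∈ U,
    ∃ (V : X.Opens) (hV : V ≤ U), x ∈ V ∧ ∃ B ∈ P.Diff V n, B.d = A.restrict hV

/-- `𝒪_X → P = Diff(𝒪_X^0, P)` is a quasi-isomorphism from `𝒪_X`, placed in degree zero, to the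
complex `Diff(𝒪_X^•, P)`. -/
structure IsQuasiIso : Prop where
  isComplex : P.IsComplex
  injective : ∀ U : X.Opens, Function.Injective (P.ι U)
  range_eq : ∀ U : X.Opens, Set.range (P.ι U) = P.H0 U
  vanishes : ∀ n : ℕ, P.CohomologySheafVanishes n

end Cohomology

end AlgebraSheaf

/-- The stalk at `x` of the tangent sheaf of `X` over `k`. -/
abbrev tangentStalk (k : Type u) [Field k] {X : Scheme.{u}} [X.Over (Spec (.of k))] (x : X) :=
  Derivation k (X.presheaf.stalk x) (X.presheaf.stalk x)

/-- The stalk at `x` of the symmetric algebra of the tangent sheaf. -/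
abbrev symStalk (k : Type u) [Field k] {X : Scheme.{u}} [X.Over (Spec (.of k))] (x : X) :=
  SymmetricAlgebra (X.presheaf.stalk x) (tangentStalk k x)

variable (k) in
/-- The homogeneous part of degree `n` of the symmetric algebra. -/
def symDegree (x : X) (n : ℕ) : Submodule (X.presheaf.stalk x) (symStalk k x) :=
  LinearMap.range (SymmetricAlgebra.ι (X.presheaf.stalk x) (tangentStalk k x)) ^ n

end Basic

/-- A sheaf of twisted differential operators on `X`: a sheaf `D` of associative `k`-algebras with
a positive, exhaustive, multiplicative filtration `D⁰ ⊆ D¹ ⊆ ⋯` by subsheaves and an isomorphism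
of sheaves of graded algebras `gr D ≅ Sym T_X`, which is the identity of `𝒪_X` in degree `0` and
in degree `1` is given by the action of `D¹` on `𝒪_X` by commutators (that is, it is compatible
with Poisson brackets). The isomorphism is given by the
symbol maps `symbol n : Dⁿ → Symⁿ T_X`, with kernel `Dⁿ⁻¹`, and they are recorded on germs:
`symbol n x U hx p` is the germ at `x` of the symbol of `p ∈ Dⁿ(U)`. -/
structure TDO (k : Type u) [Field k] (X : Scheme.{u}) [X.Over (Spec (.of k))] extends
    AlgebraSheaf k X where
  /-- the subsheaf `Dⁿ` -/
  fil : ℕ → ∀ U : X.Opens, AddSubgroup (toAlgebraSheaf.sec U)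
  fil_res : ∀ n (V W : X.Opens) (h : W ≤ V), ∀ p ∈ fil n V, toAlgebraSheaf.res h p ∈ fil n W
  fil_local : ∀ n (U : X.Opens) (p : toAlgebraSheaf.sec U),
    (∀ x ∈ U, ∃ (V : X.Opens) (h : V ≤ U), x ∈ V ∧ toAlgebraSheaf.res h p ∈ fil n V) → p ∈ fil n U
  fil_mono : ∀ n U, fil n U ≤ fil (n + 1) U
  fil_mul : ∀ m n U, ∀ p ∈ fil m U, ∀ q ∈ fil n U, p * q ∈ fil (m + n) U
  fil_exhaustive : ∀ (U : X.Opens) (p : toAlgebraSheaf.sec U), ∀ x ∈ U,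
    ∃ (V : X.Opens) (h : V ≤ U), x ∈ V ∧ ∃ n, toAlgebraSheaf.res h p ∈ fil n V
  ι_mem : ∀ (U : X.Opens) (f : Γ(X, U)), toAlgebraSheaf.ι U f ∈ fil 0 U
  /-- the germ at `x` of the symbol of a section of `Dⁿ` -/
  symbol : ∀ (n : ℕ) (x : X) (U : X.Opens), x ∈ U → fil n U →+ symStalk k x
  symbol_res : ∀ n x (V W : X.Opens) (h : W ≤ V) (hx : x ∈ W) (p : fil n V),
    symbol n x W hx ⟨toAlgebraSheaf.res h p, fil_res n V W h p p.2⟩ = symbol n x V (h hx) p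
  symbol_mem : ∀ n x U hx p, symbol n x U hx p ∈ symDegree k x n
  /-- surjectivity on stalks -/
  symbol_surjective : ∀ n x, ∀ t ∈ symDegree k x n, ∃ U hx p, symbol n x U hx p = t
  symbol_eq_zero_zero : ∀ x U hx (p : fil 0 U), symbol 0 x U hx p = 0 ↔
    ∃ (V : X.Opens) (h : V ≤ U), x ∈ V ∧ toAlgebraSheaf.res h p = 0
  symbol_eq_zero_succ : ∀ n x U hx (p : fil (n + 1) U), symbol (n + 1) x U hx p = 0 ↔
    ∃ (V : X.Opens) (h : V ≤ U), x ∈ V ∧ toAlgebraSheaf.res h p ∈ fil n V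
  symbol_mul : ∀ m n x U hx (p : fil m U) (q : fil n U),
    symbol (m + n) x U hx ⟨p * q, fil_mul m n U p p.2 q q.2⟩ =
      symbol m x U hx p * symbol n x U hx q
  /-- in degree `0` the isomorphism is the identity of `𝒪_X` -/
  symbol_ι : ∀ (x : X) (U : X.Opens) (hx : x ∈ U) (f : Γ(X, U)),
    symbol 0 x U hx ⟨toAlgebraSheaf.ι U f, ι_mem U f⟩ =
      algebraMap _ _ ((X.presheaf.germ U x hx).hom f)
  /-- in degree `1` the isomorphism sends `p ∈ D¹` to the derivation `f ↦ p f - f p` of `𝒪_X` -/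
  symbol_one : ∀ (x : X) (U : X.Opens) (hx : x ∈ U) (p : fil 1 U), ∃ τ : tangentStalk k x,
    symbol 1 x U hx p = SymmetricAlgebra.ι _ _ τ ∧
    ∀ (V : X.Opens) (h : V ≤ U) (hxV : x ∈ V) (f : Γ(X, V)), ∃ g : Γ(X, V),
      toAlgebraSheaf.ι V g = toAlgebraSheaf.res h p * toAlgebraSheaf.ι V f -
        toAlgebraSheaf.ι V f * toAlgebraSheaf.res h p ∧
      τ ((X.presheaf.germ V x hxV).hom f) = (X.presheaf.germ V x hxV).hom g

end TwistedDiff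

end

/-!
The statement is local, so let `x₁, …, x_d` be functions on an open set whose differentials are a
basis of the Kähler differentials (`exists_isCoordinateSystem`), and let `yⱼ ∈ D¹` have as symbols
the dual derivations, so that `[yⱼ, xᵢ] = δᵢⱼ` (`TDO.exists_dual_sections`). For `D^op`, which has
the same centralizer of `𝒪`, the sections `-yⱼ` play the same role, so the argument in positive
degrees applies to `P = D` and to `P = D^op`.

*Degree zero.* The zeroth cohomology is the centralizer of `𝒪` by definition of the differential.
The Euler operator `p ↦ ∑ [p, xᵢ] yᵢ` multiplies symbols of degree `n` by `n` (`TDO.euler_sub_mem`).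
In characteristic zero a section that commutes with all `xᵢ` therefore lies in `D⁰ = 𝒪`
(`TDO.exists_ι_eq_of_commutator_eq_zero`).

*Positive degrees.* Let `ξᵢ = [·, xᵢ]` and `Yᵢ` be right multiplication by `yᵢ`. Then
`ξᵢ Yᵢ - Yᵢ ξᵢ = 1`, and in characteristic zero the finite composite
`ε = ∏ᵢ ∑ₘ (-1)ᵐ / m! Yᵢᵐ ξᵢᵐ` projects a bounded part of the filtration of `P` to the functions,
like the constant term of a polynomial in the `yᵢ` (`constantTerm`). The map that takes `p` to the
differential operator `s ↦ ε(p s)` from `𝒪` to `𝒪` is injective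
(`IsLocalModel.eq_zero_of_constantTerm`) and every operator of bounded order with values in `𝒪` is
of this form (`IsLocalModel.constantTerm_coinducedLift`). Thus `P` is the coinduced bimodule
`Diff(𝒪, 𝒪)`, a cochain of `n` arguments with values in `P` is a cochain of `n + 1` arguments with
values in `𝒪`, and the Hochschild differential becomes the bar differential, which is contractible:
up to sign, the homotopy `PolyMap.homotopy` takes `A` to the `B` with
`ε(B(g₁, …, gₙ) s) = ε(A(g₁, …, gₙ, s))` (`IsLocalModel.hochschild_coinducedLift`). It is given by a
formula in the `xᵢ` and `yᵢ` and hence is compatible with restriction (`map_coinducedLift`).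

The bound on the filtration degree of the values of a polydifferential operator, which these finite
sums need and which also shows that the differential preserves polydifferential operators, is not
part of the definition. It holds because an operator of bounded order is determined by its values on
finitely many monomials in the coordinates, even modulo a step of the filtration
(`multilinearMap_eq_zero_of_monomials`, `AlgebraSheaf.IsCoordinates.exists_bound`).
-/

namespace TwistedDiff

/-! ### Differential operators on commutative algebras -/

section ModuleOrder

variable {S N N' : Type*} [CommRing S] [AddCommGroup N] [Module S N] [AddCommGroup N']
  [Module S N']

/-- Iterated commutators of a map `φ` from a commutative ring `S` to an `S`-module with
multiplication by the elements of a list, starting with its head. The map need not be additive. -/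
def iterCommutator (fs : List S) (φ : S → N) : S → N :=
  fs.foldl (fun φ f => fun s => f • φ s - φ (f * s)) φ

@[simp] theorem iterCommutator_nil (φ : S → N) : iterCommutator [] φ = φ := rfl

theorem iterCommutator_cons (f : S) (fs : List S) (φ : S → N) :
    iterCommutator (f :: fs) φ = iterCommutator fs (fun s => f • φ s - φ (f * s)) := rfl

theorem iterCommutator_comp_linearMap (u : N →ₗ[S] N') (fs : List S) (φ : S → N) :
    iterCommutator fs (fun s => u (φ s)) = fun s => u (iterCommutator fs φ s) := by
  induction fs generalizing φ with
  | nil => rfl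
  | cons f fs ih =>
    rw [iterCommutator_cons, iterCommutator_cons, ← ih]
    simp

theorem iterCommutator_zero (fs : List S) : iterCommutator fs (fun _ => (0 : N)) = 0 := by
  exact iterCommutator_comp_linearMap (0 : N →ₗ[S] N) fs (fun _ => (0 : N))

theorem iterCommutator_sub (fs : List S) (φ ψ : S → N) :
    iterCommutator fs (fun s => φ s - ψ s) = iterCommutator fs φ - iterCommutator fs ψ := by
  induction fs generalizing φ ψ with
  | nil => rfl
  | cons f fs ih =>
    rw [iterCommutator_cons, iterCommutator_cons, iterCommutator_cons, ← ih]
    congr 1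
    ext s
    simp only [smul_sub]
    abel

theorem iterCommutator_comp_mul (b : S) (fs : List S) (φ : S → N) :
    iterCommutator fs (fun s => φ (b * s)) = fun s => iterCommutator fs φ (b * s) := by
  induction fs generalizing φ with
  | nil => rfl
  | cons f fs ih =>
    rw [iterCommutator_cons, iterCommutator_cons, ← ih]
    simp [mul_left_comm]

theorem iterCommutator_append (fs gs : List S) (φ : S → N) :
    iterCommutator (fs ++ gs) φ = iterCommutator gs (iterCommutator fs φ) :=
  List.foldl_append

theorem iterCommutator_eq_zero_of_le {φ : S → N} {M M' : ℕ} (hM : M ≤ M')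
    (h : ∀ fs : List S, fs.length = M → iterCommutator fs φ = 0) (fs : List S)
    (hfs : fs.length = M') : iterCommutator fs φ = 0 := by
  rw [← List.take_append_drop M fs, iterCommutator_append, h _ (by simp [hfs, hM])]
  exact iterCommutator_zero _

variable (S N) in
/-- The differential operators of order less than `M` from `S` to `N`. The bound is strict, so that
`M = 0` is the zero operator. -/
def diffOps (M : ℕ) : AddSubgroup (S → N) :=
  AddSubgroup.ofSub {φ | ∀ fs : List S, fs.length = M → iterCommutator fs φ = 0}
    ⟨0, fun fs _ => iterCommutator_zero fs⟩ (by
      intro φ hφ ψ hψ fs hfs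
      rw [← sub_eq_add_neg]
      exact (iterCommutator_sub fs φ ψ).trans (by rw [hφ fs hfs, hψ fs hfs, sub_zero]))

theorem comp_mem_diffOps (u : N →ₗ[S] N') {M : ℕ}
    {φ : S → N} (hφ : φ ∈ diffOps S N M) : (fun s => u (φ s)) ∈ diffOps S N' M := by
  intro fs hfs
  rw [iterCommutator_comp_linearMap, hφ fs hfs]
  ext
  simp

theorem comp_mul_mem_diffOps (b : S) {M : ℕ} {φ : S → N} (hφ : φ ∈ diffOps S N M) :
    (fun s => φ (b * s)) ∈ diffOps S N M := by
  intro fs hfs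
  rw [iterCommutator_comp_mul, hφ fs hfs]
  rfl

end ModuleOrder

section Monomials

variable {k S N : Type*} [CommRing k] [CommRing S] [Algebra k S] [AddCommGroup N] [Module S N]
  [Module k N] [IsScalarTower k S N] {σ : Type*} {x : σ → S}

theorem derivation_eq_zero
    (hx : Submodule.span S (Set.range fun i => KaehlerDifferential.D k S (x i)) = ⊤)
    (δ : Derivation k S N) (h : ∀ i, δ (x i) = 0) : δ = 0 := by
  rw [← δ.liftKaehlerDifferential_comp]
  have : δ.liftKaehlerDifferential = 0 := by
    refine LinearMap.ext_on hx ?_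
    rintro _ ⟨i, rfl⟩
    simp [h]
  rw [this]
  ext
  simp

/-- A differential operator that commutes with multiplication by functions whose differentials
span the Kähler differentials is linear: by induction on the order, `f ↦ [f, ψ]` amounts to a
derivation that vanishes on these functions. -/
theorem apply_eq_smul_of_commute
    (hx : Submodule.span S (Set.range fun i => KaehlerDifferential.D k S (x i)) = ⊤) (M : ℕ)
    (ψ : S →ₗ[k] N) (hψ : ∀ fs : List S, fs.length = M → iterCommutator fs ψ = 0)
    (hc : ∀ i s, ψ (x i * s) = x i • ψ s) (s : S) : ψ s = s • ψ 1 := by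
  induction M generalizing ψ s with
  | zero =>
    have : ⇑ψ = 0 := hψ [] rfl
    simp [this]
  | succ M ih =>
    let C (f : S) : S →ₗ[k] N := (LinearMap.lsmul S N f).restrictScalars k ∘ₗ ψ -
      ψ ∘ₗ LinearMap.mulLeft k f
    have hC (f s : S) : C f s = f • ψ s - ψ (f * s) := rfl
    have key (f s : S) : C f s = s • C f 1 := by
      refine ih (C f) (fun fs hfs => hψ (f :: fs) (by simp [hfs])) (fun i s => ?_) s
      rw [hC, hC, mul_left_comm, hc, hc, smul_sub, smul_comm]
    let δ : Derivation k S N := Derivation.mk'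
      { toFun := fun f => C f 1
        map_add' := fun f g => by simp only [hC, mul_one, add_smul, map_add]; abel
        map_smul' := fun c f => by
          simp only [hC, mul_one, map_smul, smul_assoc, smul_sub, RingHom.id_apply] } (by
        intro f g
        change C (f * g) 1 = f • C g 1 + g • C f 1
        rw [← key f g, hC, hC, hC]
        simp [mul_smul, smul_sub])
    have hδ : δ = 0 := derivation_eq_zero hx δ fun i => by
      change C (x i) 1 = 0
      rw [hC, hc, sub_self]
    have h1 : C s 1 = 0 := congrArg (fun δ : Derivation k S N => δ s) hδ
    rw [hC, mul_one, sub_eq_zero] at h1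
    exact h1.symm

/-- A differential operator of order less than `M` is determined by its values on the monomials of
degree less than `M` in functions `x i` whose differentials span the Kähler differentials: by
induction its commutators with the `x i` vanish, so that it is linear. -/
theorem eq_zero_of_monomials
    (hx : Submodule.span S (Set.range fun i => KaehlerDifferential.D k S (x i)) = ⊤) (M : ℕ)
    (ψ : S →ₗ[k] N) (hψ : ∀ fs : List S, fs.length = M → iterCommutator fs ψ = 0)
    (h0 : ∀ l : List σ, l.length < M → ψ (l.map x).prod = 0) : ψ = 0 := by
  induction M generalizing ψ with
  | zero => exact DFunLike.coe_injective (hψ [] rfl)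
  | succ M ih =>
    let C (f : S) : S →ₗ[k] N := (LinearMap.lsmul S N f).restrictScalars k ∘ₗ ψ -
      ψ ∘ₗ LinearMap.mulLeft k f
    have hC (f s : S) : C f s = f • ψ s - ψ (f * s) := rfl
    have hz (i : σ) : C (x i) = 0 := by
      refine ih _ (fun fs hfs => hψ (x i :: fs) (by simp [hfs])) fun l hl => ?_
      rw [hC, h0 l (by omega), smul_zero, zero_sub, neg_eq_zero]
      simpa using h0 (i :: l) (by simpa using hl)
    have h1 : ψ 1 = 0 := by simpa using h0 [] (by simp)
    ext s
    rw [apply_eq_smul_of_commute hx (M + 1) ψ hψ, h1, smul_zero, LinearMap.zero_apply]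
    intro i s
    have := congrArg (fun φ : S →ₗ[k] N => φ s) (hz i)
    simp only [hC, LinearMap.zero_apply, sub_eq_zero] at this
    exact this.symm

/-- The version of `eq_zero_of_monomials` for multidifferential operators. -/
theorem multilinearMap_eq_zero_of_monomials
    (hx : Submodule.span S (Set.range fun i => KaehlerDifferential.D k S (x i)) = ⊤) {n : ℕ}
    (M : Fin n → ℕ) (A : MultilinearMap k (fun _ : Fin n => S) N)
    (hA : ∀ (j : Fin n) (g : Fin n → S) (fs : List S), fs.length = M j →
      iterCommutator fs (fun s => A (Function.update g j s)) = 0)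
    (h0 : ∀ l : Fin n → List σ, (∀ j, (l j).length < M j) →
      A (fun j => ((l j).map x).prod) = 0) : A = 0 := by
  -- The arguments are freed one at a time: the first `j` are arbitrary, the others monomials.
  have key (j : ℕ) (hj : j ≤ n) (g : Fin n → S) (l : Fin n → List σ)
      (hl : ∀ j, (l j).length < M j) :
      A (fun i => if i.1 < j then g i else ((l i).map x).prod) = 0 := by
    induction j generalizing g l with
    | zero => simpa using h0 l hl
    | succ j ih =>
      let g' : Fin n → S := fun i => if i.1 < j then g i else ((l i).map x).prod
      have hg (s : S) : (fun i => if i.1 < j + 1 then Function.update g ⟨j, hj⟩ s i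
          else ((l i).map x).prod) = Function.update g' ⟨j, hj⟩ s := by
        ext i
        simp only [Function.update_apply, Fin.ext_iff, g']
        grind
      have hz := eq_zero_of_monomials hx (M ⟨j, hj⟩) (A.toLinearMap g' ⟨j, hj⟩)
        (hA ⟨j, hj⟩ g') fun m hm => by
          rw [MultilinearMap.toLinearMap_apply]
          have := ih (by omega) g (Function.update l ⟨j, hj⟩ m) fun i => by
            by_cases hi : i = ⟨j, hj⟩
            · subst hi; simpa using hm
            · simpa [Function.update_of_ne hi] using hl i
          convert! this using 2
          ext i
          simp only [Function.update_apply, Fin.ext_iff, g']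
          grind
      have := congrArg (fun φ : S →ₗ[k] N => φ (g ⟨j, hj⟩)) hz
      simp only [MultilinearMap.toLinearMap_apply, ← hg, Function.update_eq_self] at this
      exact this
  ext g
  by_cases hM : ∃ j, M j = 0
  · obtain ⟨j, hj⟩ := hM
    have := congrFun (hA j g [] (by simp [hj])) (g j)
    simpa using this
  · push Not at hM
    simpa using key n le_rfl g (fun _ => []) fun j => by simpa using Nat.pos_of_ne_zero (hM j)

end Monomials

/-! ### Projections in the Weyl algebra -/

section Weyl

variable (k : Type*) {E : Type*} [Field k] [Ring E] [Algebra k E]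

/-- For elements with `[a, b] = 1`, the truncated series `∑ (-1)ᵐ / m! bᵐ aᵐ`, which
projects the elements killed by `a ^ M` onto the kernel of `a`. -/
def weylProj (M : ℕ) (a b : E) : E :=
  ∑ m ∈ Finset.range M, ((-1) ^ m * (m.factorial : k)⁻¹) • (b ^ m * a ^ m)

variable {k}

theorem weylProj_succ (M : ℕ) (a b : E) : weylProj k (M + 1) a b =
    weylProj k M a b + ((-1) ^ M * (M.factorial : k)⁻¹) • (b ^ M * a ^ M) :=
  Finset.sum_range_succ _ _

theorem weylProj_one (a b : E) : weylProj k 1 a b = 1 := by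
  simp [weylProj]

theorem commute_weylProj {c a b : E} (ha : Commute c a) (hb : Commute c b) (M : ℕ) :
    Commute c (weylProj k M a b) :=
  Commute.sum_right _ _ _ fun _ _ =>
    ((hb.pow_right _).mul_right (ha.pow_right _)).smul_right _

theorem mul_pow_of_bracket {a b : E} (h : a * b = b * a + 1) (m : ℕ) :
    a * b ^ (m + 1) = b ^ (m + 1) * a + (m + 1) • b ^ m := by
  induction m with
  | zero => simp [h]
  | succ m ih =>
    rw [pow_succ, ← mul_assoc, ih, add_mul, mul_assoc, h, mul_add, mul_one, smul_mul_assoc,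
      ← pow_succ, ← mul_assoc, ← pow_succ, add_assoc, succ_nsmul _ (m + 1),
      add_comm (b ^ (m + 1))]

theorem pow_mul_of_bracket {a b : E} (h : a * b = b * a + 1) (m : ℕ) :
    a ^ (m + 1) * b = b * a ^ (m + 1) + (m + 1) • a ^ m := by
  induction m with
  | zero => simp [h]
  | succ m ih =>
    rw [pow_succ', mul_assoc, ih, mul_add, ← mul_assoc, h, add_mul, one_mul, mul_smul_comm,
      ← pow_succ', mul_assoc, ← pow_succ', add_assoc, succ_nsmul _ (m + 1),
      add_comm (a ^ (m + 1))]

variable [CharZero k]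

/-- The recursion of the coefficients that makes the series in `mul_weylProj` telescope. -/
theorem coeff_succ (M : ℕ) :
    ((-1) ^ (M + 1) * ((M + 1).factorial : k)⁻¹) * ((M + 1 : ℕ) : k) =
      -((-1) ^ M * (M.factorial : k)⁻¹) := by
  have h1 : ((M + 1 : ℕ) : k) ≠ 0 := Nat.cast_ne_zero.2 (Nat.succ_ne_zero M)
  have h2 : (M.factorial : k) ≠ 0 := Nat.cast_ne_zero.2 (Nat.factorial_ne_zero M)
  rw [Nat.factorial_succ, Nat.cast_mul]
  field_simp
  ring

/-- The product telescopes to its last term, which vanishes on the kernel of `a ^ (M + 1)`. -/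
theorem mul_weylProj {a b : E} (h : a * b = b * a + 1) (M : ℕ) :
    a * weylProj k (M + 1) a b = ((-1) ^ M * (M.factorial : k)⁻¹) • (b ^ M * a ^ (M + 1)) := by
  induction M with
  | zero => simp [weylProj_one]
  | succ M ih =>
    rw [weylProj_succ, mul_add, ih, mul_smul_comm, ← mul_assoc, mul_pow_of_bracket h,
      add_mul, smul_add, ← Nat.cast_smul_eq_nsmul k, smul_mul_assoc, smul_smul, coeff_succ,
      neg_smul, mul_assoc, ← pow_succ']
    abel

theorem weylProj_mul {a b : E} (h : a * b = b * a + 1) (M : ℕ) :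
    weylProj k (M + 1) a b * b = ((-1) ^ M * (M.factorial : k)⁻¹) • (b ^ (M + 1) * a ^ M) := by
  induction M with
  | zero => simp [weylProj_one]
  | succ M ih =>
    rw [weylProj_succ, add_mul, ih, smul_mul_assoc, mul_assoc, pow_mul_of_bracket h,
      mul_add, ← Nat.cast_smul_eq_nsmul k, ← mul_assoc, ← pow_succ, mul_smul_comm, smul_add,
      smul_smul, coeff_succ, neg_smul]
    abel

end Weyl

section WeylModule

variable (k : Type*) {S G : Type*} [Field k] [CommRing S] [Algebra k S] [AddCommGroup G]
  [Module S G] [Module k G] [IsScalarTower k S G] {σ : Type*}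

/-- The composite of the operators `weylProj` for the indices in a list. -/
def weylProjList (M : ℕ) (a b : σ → Module.End S G) (l : List σ) : Module.End S G :=
  (l.map fun i => weylProj k M (a i) (b i)).prod

variable {k}

theorem weylProjList_cons (M : ℕ) (a b : σ → Module.End S G) (i : σ) (l : List σ) :
    weylProjList k M a b (i :: l) = weylProj k M (a i) (b i) * weylProjList k M a b l := by
  simp [weylProjList]

theorem commute_weylProjList {c : Module.End S G} {M : ℕ} {a b : σ → Module.End S G} {l : List σ}
    (ha : ∀ i ∈ l, Commute c (a i)) (hb : ∀ i ∈ l, Commute c (b i)) :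
    Commute c (weylProjList k M a b l) := by
  refine Commute.list_prod_right _ _ fun d hd => ?_
  obtain ⟨i, hi, rfl⟩ := List.mem_map.1 hd
  exact commute_weylProj (ha i hi) (hb i hi) M

theorem weylProj_apply_mem {a b : Module.End S G} (U : AddSubgroup G)
    (hk : ∀ (c : k), ∀ g ∈ U, c • g ∈ U) (ha : ∀ g ∈ U, a g ∈ U) (hb : ∀ g ∈ U, b g ∈ U) (M : ℕ)
    {g : G} (hg : g ∈ U) : weylProj k M a b g ∈ U := by
  have hpow {c : Module.End S G} (hc : ∀ g ∈ U, c g ∈ U) (m : ℕ) : ∀ g ∈ U, (c ^ m) g ∈ U := by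
    induction m with
    | zero => exact fun g hg => hg
    | succ m ih =>
      intro g hg
      rw [pow_succ]
      exact ih _ (hc g hg)
  rw [weylProj, LinearMap.sum_apply]
  exact sum_mem fun m _ => hk _ _ (hpow hb m _ (hpow ha m _ hg))

theorem weylProjList_apply_mem {a b : σ → Module.End S G} (U : AddSubgroup G)
    (hk : ∀ (c : k), ∀ g ∈ U, c • g ∈ U) (ha : ∀ i, ∀ g ∈ U, a i g ∈ U)
    (hb : ∀ i, ∀ g ∈ U, b i g ∈ U) (M : ℕ) (l : List σ) {g : G} (hg : g ∈ U) :
    weylProjList k M a b l g ∈ U := by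
  induction l with
  | nil => exact hg
  | cons i l ih =>
    rw [weylProjList_cons]
    exact weylProj_apply_mem U hk (ha i) (hb i) M ih

theorem weylProj_apply_of_eq_zero {a b : Module.End S G} {g : G} (M : ℕ) (hg : a g = 0) :
    weylProj k (M + 1) a b g = g := by
  induction M with
  | zero => simp [weylProj_one]
  | succ M ih => rw [weylProj_succ, LinearMap.add_apply, ih]; simp [pow_succ a, hg]

theorem weylProjList_apply_of_eq_zero {a b : σ → Module.End S G} {g : G} (M : ℕ) (l : List σ)
    (hg : ∀ i ∈ l, a i g = 0) : weylProjList k (M + 1) a b l g = g := by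
  induction l with
  | nil => rfl
  | cons i l ih =>
    rw [weylProjList_cons, Module.End.mul_apply, ih fun j hj => hg j (List.mem_cons_of_mem i hj),
      weylProj_apply_of_eq_zero M (hg i List.mem_cons_self)]

section Intertwine

variable {S' H : Type*} [CommRing S'] [Algebra k S'] [AddCommGroup H]
  [Module S' H] [Module k H] [IsScalarTower k S' H]

theorem weylProj_intertwine {a b : Module.End S G} {a' b' : Module.End S' H} (t : G →ₗ[k] H)
    (ha : ∀ g, t (a g) = a' (t g)) (hb : ∀ g, t (b g) = b' (t g)) (M : ℕ) (g : G) :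
    t (weylProj k M a b g) = weylProj k M a' b' (t g) := by
  have hpow {c : Module.End S G} {c' : Module.End S' H} (hc : ∀ g, t (c g) = c' (t g)) (m : ℕ)
      (g : G) : t ((c ^ m) g) = (c' ^ m) (t g) := by
    induction m generalizing g with
    | zero => rfl
    | succ m ih => rw [pow_succ, pow_succ, Module.End.mul_apply, ih, hc, Module.End.mul_apply]
  simp only [weylProj, LinearMap.sum_apply, map_sum, LinearMap.smul_apply, map_smul,
    Module.End.mul_apply, hpow ha, hpow hb]

theorem weylProjList_intertwine {a b : σ → Module.End S G} {a' b' : σ → Module.End S' H}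
    (t : G →ₗ[k] H) (ha : ∀ i g, t (a i g) = a' i (t g)) (hb : ∀ i g, t (b i g) = b' i (t g))
    (M : ℕ) (l : List σ) (g : G) :
    t (weylProjList k M a b l g) = weylProjList k M a' b' l (t g) := by
  induction l with
  | nil => rfl
  | cons i l ih =>
    rw [weylProjList_cons, weylProjList_cons, Module.End.mul_apply, Module.End.mul_apply,
      weylProj_intertwine t (ha i) (hb i), ih]

end Intertwine

variable [CharZero k]

/-- The operator `weylProjList` maps elements killed by powers of the `a i` to the common kernel of
the `a i`. -/
theorem apply_weylProjList_eq_zero {a b : σ → Module.End S G}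
    (haa : ∀ i j, Commute (a i) (a j)) (hab : ∀ i, a i * b i = b i * a i + 1)
    (hne : ∀ i j, i ≠ j → Commute (a i) (b j)) (M : ℕ) {l : List σ} (hl : l.Nodup) {g : G}
    (hg : ∀ i ∈ l, (a i ^ (M + 1)) g = 0) : ∀ i ∈ l, a i (weylProjList k (M + 1) a b l g) = 0 := by
  induction l with
  | nil => simp
  | cons i l ih =>
    have hl' := List.nodup_cons.1 hl
    have ih := ih hl'.2 fun j hj => hg j (List.mem_cons_of_mem i hj)
    have hcomm : Commute (a i ^ (M + 1)) (weylProjList k (M + 1) a b l) :=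
      Commute.pow_left (commute_weylProjList (fun j _ => haa i j) fun j hj =>
        hne i j (ne_of_mem_of_not_mem hj hl'.1).symm) _
    intro j hj
    rw [weylProjList_cons, Module.End.mul_apply, ← Module.End.mul_apply (a j)]
    -- The outermost factor maps to the kernel of `a i`, and it commutes with `a j` for `j ≠ i`.
    rcases List.mem_cons.1 hj with rfl | hj
    · rw [mul_weylProj (hab j), LinearMap.smul_apply, Module.End.mul_apply,
        ← Module.End.mul_apply (a j ^ _), hcomm.eq, Module.End.mul_apply,
        hg j List.mem_cons_self, map_zero, map_zero, smul_zero]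
    · have hij : j ≠ i := ne_of_mem_of_not_mem hj hl'.1
      rw [(commute_weylProj (k := k) (haa j i) (hne j i hij) (M + 1)).eq, Module.End.mul_apply,
        ih j hj, map_zero]

theorem pow_apply_pow_eq_zero {a b : Module.End S G} (h : a * b = b * a + 1) {g : G}
    (hg : a g = 0) (m n : ℕ) (hmn : m < n) : (a ^ n) ((b ^ m) g) = 0 := by
  induction n generalizing m with
  | zero => omega
  | succ n ih =>
    cases m with
    | zero => simp [pow_succ, hg]
    | succ m =>
      rw [pow_succ a, Module.End.mul_apply, ← Module.End.mul_apply a, mul_pow_of_bracket h,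
        LinearMap.add_apply, Module.End.mul_apply, hg, map_zero, zero_add, LinearMap.smul_apply,
        map_nsmul, ih m (by omega), smul_zero]

/-- If `b` is the adjoint variable for `a` and `-b` is the one for `c`, the projection to the
kernel of `c` can be undone on the kernel of `a`. -/
theorem weylProj_weylProj {a b c : Module.End S G} (hab : a * b = b * a + 1) (hac : Commute a c)
    (M : ℕ) {g : G} (hg : a g = 0) :
    weylProj k (M + 1) a b (weylProj k (M + 1) c (-b) g) = g := by
  have key (m : ℕ) (hm : m ≤ M) : weylProj k (M + 1) a b (weylProj k (m + 1) c (-b) g) = g := by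
    induction m with
    | zero => simpa [weylProj_one] using weylProj_apply_of_eq_zero M hg
    | succ m ih =>
      rw [weylProj_succ (m + 1), LinearMap.add_apply, map_add, ih (by omega), add_eq_left,
        LinearMap.smul_apply, LinearMap.map_smul_of_tower, Module.End.mul_apply, neg_pow b]
      have h1 : a ((c ^ (m + 1)) g) = 0 := by
        rw [← Module.End.mul_apply, (hac.pow_right _).eq, Module.End.mul_apply, hg, map_zero]
      set u := (c ^ (m + 1)) g
      have h2 : weylProj k (M + 1) a b ((b ^ (m + 1)) u) = 0 := by
        rw [pow_succ', Module.End.mul_apply, ← Module.End.mul_apply (weylProj k _ a b),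
          weylProj_mul hab, LinearMap.smul_apply, Module.End.mul_apply,
          pow_apply_pow_eq_zero hab h1 m M (by omega), map_zero, smul_zero]
      rcases neg_one_pow_eq_or (Module.End S G) (m + 1) with h | h <;> simp [h, h2]
  exact key M le_rfl

/-- The version of `weylProj_weylProj` for several pairs of variables. The order of the list is
reversed because the projections are undone one after the other, from the outside. -/
theorem weylProjList_weylProjList {a b c : σ → Module.End S G}
    (hab : ∀ i, a i * b i = b i * a i + 1)
    (hne : ∀ i j, i ≠ j → Commute (a i) (b j)) (hac : ∀ i j, Commute (a i) (c j)) (M : ℕ)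
    {l : List σ} (hl : l.Nodup) {g : G} (hg : ∀ i ∈ l, a i g = 0) :
    weylProjList k (M + 1) a b l.reverse (weylProjList k (M + 1) c (fun i => -b i) l g) = g := by
  induction l with
  | nil => rfl
  | cons i l ih =>
    have hl' := List.nodup_cons.1 hl
    have h1 : weylProjList k (M + 1) a b (i :: l).reverse =
        weylProjList k (M + 1) a b l.reverse * weylProj k (M + 1) (a i) (b i) := by
      simp [weylProjList]
    have h2 : a i (weylProjList k (M + 1) c (fun i => -b i) l g) = 0 := by
      have : Commute (a i) (weylProjList k (M + 1) c (fun i => -b i) l) :=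
        commute_weylProjList (fun j _ => hac i j) fun j hj =>
          (hne i j (ne_of_mem_of_not_mem hj hl'.1).symm).neg_right
      rw [← Module.End.mul_apply, this.eq, Module.End.mul_apply, hg i List.mem_cons_self, map_zero]
    rw [h1, Module.End.mul_apply, weylProjList_cons, Module.End.mul_apply,
      weylProj_weylProj (hab i) (hac i i) M h2,
      ih hl'.2 fun j hj => hg j (List.mem_cons_of_mem i hj)]

end WeylModule

/-! ### Bimodules with local coordinates -/

section Operators

variable (k : Type*) {S R : Type*} [Field k] [CommRing S] [Algebra k S] [Ring R] [Algebra k R]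
  [Module S R] [IsScalarTower k S R] [IsScalarTower S R R]

variable (R) in
/-- The difference `p ↦ p f - f p` of the right and the left action of `f`. -/
def commutatorEnd (f : S) : Module.End S R :=
  LinearMap.mulRight S (f • (1 : R)) - LinearMap.lsmul S R f

theorem commutatorEnd_apply (f : S) (p : R) : commutatorEnd R f p = p * (f • 1) - f • p := rfl

/-- Composition with an endomorphism of the target. -/
def postcomp (u : Module.End S R) : Module.End S (S →ₗ[k] R) where
  toFun φ := u.restrictScalars k ∘ₗ φ
  map_add' _ _ := LinearMap.comp_add _ _ _
  map_smul' _ _ := LinearMap.ext fun _ => by simp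

omit [IsScalarTower S R R] in
@[simp] theorem postcomp_apply (u : Module.End S R) (φ : S →ₗ[k] R) (s : S) :
    postcomp k u φ s = u (φ s) := rfl

variable (R) in
/-- The operator that takes `φ` to `s ↦ φ (f s) - φ(s) f`. Its kernel consists of the maps
that commute with the right action of `f`. -/
def shiftEnd (f : S) : Module.End S (S →ₗ[k] R) where
  toFun φ := φ ∘ₗ LinearMap.mulLeft k f - postcomp k (LinearMap.mulRight S (f • (1 : R))) φ
  map_add' _ _ := LinearMap.ext fun _ => by simp; abel
  map_smul' _ _ := LinearMap.ext fun _ => by simp [smul_sub]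

@[simp] theorem shiftEnd_apply (f : S) (φ : S →ₗ[k] R) (s : S) :
    shiftEnd k R f φ s = φ (f * s) - φ s * (f • 1) := rfl

/-- Right multiplication of an element of filtration `n` by functions is a differential operator of
order at most `n` for the left action. -/
theorem iterCommutator_mul_eq_zero {F : ℕ → AddSubgroup R}
    (hF : ∀ n (f : S), ∀ p ∈ F (n + 1), commutatorEnd R f p ∈ F n)
    (hF0 : ∀ (f : S), ∀ p ∈ F 0, commutatorEnd R f p = 0) (n : ℕ) {p : R} (hp : p ∈ F n)
    (fs : List S) (hfs : fs.length = n + 1) :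
    iterCommutator fs (fun s => p * (s • 1)) = 0 := by
  have key (f : S) (p : R) : (fun s : S => f • (p * (s • (1 : R))) - p * ((f * s) • 1)) =
      fun s => -commutatorEnd R f p * (s • 1) := by
    ext s
    rw [commutatorEnd_apply, neg_sub, sub_mul, smul_mul_assoc, mul_assoc, smul_mul_assoc, one_mul,
      mul_smul]
  induction n generalizing p fs with
  | zero =>
    obtain ⟨f, rfl⟩ := List.length_eq_one_iff.1 hfs
    rw [iterCommutator_cons, key, hF0 f p hp]
    ext s
    simp
  | succ n ih =>
    obtain ⟨f, fs, rfl⟩ := List.exists_cons_of_length_eq_add_one hfs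
    rw [iterCommutator_cons, key]
    exact ih (neg_mem (hF n f p hp)) fs (by simpa using hfs)

end Operators

section LocalModel

/-- Local coordinates for an algebra `R` with a left action of a commutative `k`-algebra `S`, where
the right action of `f : S` is multiplication by `f • 1`. The differentials of the functions `x i`
span the Kähler differentials, the `y i` are dual to them with respect to commutators,
and commutators with functions lower the filtration `F`. -/
structure IsLocalModel (k : Type*) {S R : Type*} [Field k] [CommRing S] [Algebra k S] [Ring R]
    [Algebra k R] [Module S R] [IsScalarTower k S R] [IsScalarTower S R R] {d : ℕ}
    (F : ℕ → AddSubgroup R) (x : Fin d → S) (y : Fin d → R) : Prop where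
  span_eq_top : Submodule.span S (Set.range fun i => KaehlerDifferential.D k S (x i)) = ⊤
  commutator_y : ∀ i j, commutatorEnd R (x i) (y j) = if i = j then 1 else 0
  mono : Monotone F
  smul_mem : ∀ n (f : S), ∀ p ∈ F n, f • p ∈ F n
  commutator_mem : ∀ n (f : S), ∀ p ∈ F (n + 1), commutatorEnd R f p ∈ F n
  commutator_zero : ∀ (f : S), ∀ p ∈ F 0, commutatorEnd R f p = 0
  mul_y_mem : ∀ n i, ∀ p ∈ F n, p * y i ∈ F (n + 1)

variable (k : Type*) {S R : Type*} [Field k] [CommRing S] [Algebra k S] [Ring R]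
  [Algebra k R] [Module S R] [IsScalarTower k S R] [IsScalarTower S R R] {d : ℕ}

/-- The projection of the part of `R` of filtration at most `M` to the common kernel of the
commutators with the coordinates. The order of the factors is opposite to the one in
`rightLinearize`, as `weylProjList_weylProjList` requires. -/
def constantTerm (M : ℕ) (x : Fin d → S) (y : Fin d → R) : Module.End S R :=
  weylProjList k (M + 1) (fun i => commutatorEnd R (x i)) (fun i => LinearMap.mulRight S (y i))
    (List.finRange d).reverse

/-- The operator that replaces a differential operator `φ` with constant values by a map which
commutes with the right action of the coordinates and still has the constant term `φ`. It is the
projection to the kernel of the operators `shiftEnd`, for which the `-y i` are dual variables. -/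
def rightLinearize (M : ℕ) (x : Fin d → S) (y : Fin d → R) : Module.End S (S →ₗ[k] R) :=
  weylProjList k (M + 1) (fun i => shiftEnd k R (x i))
    (fun i => -postcomp k (LinearMap.mulRight S (y i))) (List.finRange d)

/-- The element `p` for which `s ↦ p s` has the same constant term as `φ`, for `φ` of order and
values bounded by `M`; see `constantTerm_coinducedLift`. -/
def coinducedLift (M : ℕ) (x : Fin d → S) (y : Fin d → R) : (S →ₗ[k] R) →ₗ[S] R where
  toFun φ := rightLinearize k M x y (postcomp k (constantTerm k M x y) φ) 1
  map_add' φ ψ := by simp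
  map_smul' f φ := by simp

theorem coinducedLift_apply (M : ℕ) (x : Fin d → S) (y : Fin d → R) (φ : S →ₗ[k] R) :
    coinducedLift k M x y φ =
      rightLinearize k M x y (postcomp k (constantTerm k M x y) φ) 1 := rfl

variable {k}

theorem commute_commutatorEnd (f g : S) : Commute (commutatorEnd R f) (commutatorEnd R g) := by
  ext p
  simp only [Module.End.mul_apply, commutatorEnd_apply, sub_mul, mul_assoc, smul_mul_assoc,
    smul_sub, one_mul]
  rw [smul_comm f g (1 : R), smul_comm f g p]
  abel

theorem commute_shiftEnd (f g : S) : Commute (shiftEnd k R f) (shiftEnd k R g) := by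
  ext φ s
  simp only [Module.End.mul_apply, shiftEnd_apply, sub_mul, mul_assoc, smul_mul_assoc, one_mul,
    mul_left_comm f g]
  rw [smul_comm f g (1 : R)]
  abel

omit [IsScalarTower S R R] in
theorem commute_postcomp {u v : Module.End S R} (h : Commute u v) :
    Commute (postcomp k u) (postcomp k v) := by
  ext φ s
  exact congrArg (fun w : Module.End S R => w (φ s)) h.eq

theorem commute_postcomp_commutatorEnd_shiftEnd (f g : S) :
    Commute (postcomp k (commutatorEnd R f)) (shiftEnd k R g) := by
  ext φ s
  simp only [Module.End.mul_apply, shiftEnd_apply, postcomp_apply, commutatorEnd_apply, sub_mul,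
    mul_assoc, smul_mul_assoc, one_mul, smul_sub]
  rw [smul_comm f g (1 : R)]
  abel

namespace IsLocalModel

variable {F : ℕ → AddSubgroup R} {x : Fin d → S} {y : Fin d → R} (h : IsLocalModel k F x y)

include h

theorem bracket (i j : Fin d) (p : R) : commutatorEnd R (x i) (p * y j) =
    commutatorEnd R (x i) p * y j + if i = j then p else 0 := by
  have := h.commutator_y i j
  rw [commutatorEnd_apply, sub_eq_iff_eq_add] at this
  rw [commutatorEnd_apply, commutatorEnd_apply, mul_assoc, this, mul_add, sub_mul, smul_mul_assoc,
    mul_assoc, smul_mul_assoc, one_mul]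
  split_ifs
  · simp; abel
  · simp

theorem commutator_mul_y (i : Fin d) :
    commutatorEnd R (x i) * LinearMap.mulRight S (y i) =
      LinearMap.mulRight S (y i) * commutatorEnd R (x i) + 1 := by
  ext p
  simp [h.bracket]

theorem commute_commutator_mul_y {i j : Fin d} (hij : i ≠ j) :
    Commute (commutatorEnd R (x i)) (LinearMap.mulRight S (y j)) := by
  ext p
  simp [h.bracket, hij]

theorem shiftEnd_bracket (i j : Fin d) (φ : S →ₗ[k] R) :
    shiftEnd k R (x i) (postcomp k (LinearMap.mulRight S (y j)) φ) =
      postcomp k (LinearMap.mulRight S (y j)) (shiftEnd k R (x i) φ) - if i = j then φ else 0 := by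
  have := h.commutator_y i j
  rw [commutatorEnd_apply, sub_eq_iff_eq_add] at this
  ext s
  simp only [shiftEnd_apply, postcomp_apply, LinearMap.mulRight_apply, LinearMap.sub_apply,
    mul_assoc, this, sub_mul, mul_add, smul_mul_assoc, one_mul]
  split_ifs <;> simp
  abel

theorem commutator_pow (n : ℕ) (f : S) {p : R} (hp : p ∈ F n) :
    (commutatorEnd R f ^ (n + 1)) p = 0 := by
  induction n generalizing p with
  | zero => simpa using h.commutator_zero f p hp
  | succ n ih =>
    rw [pow_succ, Module.End.mul_apply]
    exact ih (h.commutator_mem n f p hp)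

theorem commutator_constantTerm {M : ℕ} [CharZero k] {p : R} (hp : p ∈ F M) (i : Fin d) :
    commutatorEnd R (x i) (constantTerm k M x y p) = 0 :=
  apply_weylProjList_eq_zero (fun _ _ => commute_commutatorEnd _ _) h.commutator_mul_y
    (fun _ _ => h.commute_commutator_mul_y) M (List.nodup_reverse.2 (List.nodup_finRange d))
    (fun i _ => h.commutator_pow M (x i) hp) i (by simp)

omit [IsScalarTower k S R] h in
theorem constantTerm_of_commutator_eq_zero [IsScalarTower k S R] (M : ℕ) {p : R}
    (hp : ∀ i, commutatorEnd R (x i) p = 0) : constantTerm k M x y p = p :=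
  weylProjList_apply_of_eq_zero M _ fun i _ => hp i

/-- An element `p` is determined by the constant terms of the products `p s`: by induction on the
filtration its commutators with the coordinates vanish, so that `p` is its own constant term. -/
theorem eq_zero_of_constantTerm (M n : ℕ) {p : R} (hp : p ∈ F n)
    (h0 : ∀ s : S, constantTerm k M x y (p * (s • 1)) = 0) : p = 0 := by
  have key (hz : ∀ i, commutatorEnd R (x i) p = 0) : p = 0 := by
    rw [← constantTerm_of_commutator_eq_zero (k := k) (y := y) M hz]
    simpa using h0 1
  induction n generalizing p with
  | zero => exact key fun i => h.commutator_zero _ p hp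
  | succ n ih =>
    have hz (i : Fin d) (s : S) :
        constantTerm k M x y (commutatorEnd R (x i) p * (s • 1)) = 0 := by
      rw [commutatorEnd_apply, sub_mul, map_sub, smul_mul_assoc, map_smul, h0, smul_zero,
        mul_assoc, smul_mul_assoc, one_mul, smul_smul, h0, sub_zero]
    refine key fun i => ih (h.commutator_mem n _ p hp) (hz i) fun hz' => ?_
    rw [← constantTerm_of_commutator_eq_zero (k := k) (y := y) M hz']
    simpa using hz i 1

theorem iterCommutator_mul (n : ℕ) {p : R} (hp : p ∈ F n) (fs : List S) (hfs : fs.length = n + 1) :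
    iterCommutator fs (fun s => p * (s • 1)) = 0 :=
  iterCommutator_mul_eq_zero h.commutator_mem h.commutator_zero n hp fs hfs

theorem exists_union : ∃ B : AddSubgroup R, ∀ p, p ∈ B ↔ ∃ n, p ∈ F n :=
  ⟨⨆ n, F n, fun _ => AddSubgroup.mem_iSup_of_directed h.mono.directed_le⟩

theorem mul_smul_one_mem {n : ℕ} (f : S) {p : R} (hp : p ∈ F n) : p * (f • 1) ∈ F n := by
  have h1 : commutatorEnd R f p ∈ F n := by
    cases n with
    | zero => rw [h.commutator_zero f p hp]; exact zero_mem _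
    | succ n => exact h.mono (Nat.le_succ n) (h.commutator_mem n f p hp)
  rw [commutatorEnd_apply] at h1
  simpa using add_mem h1 (h.smul_mem n f p hp)

theorem algebra_smul_mem {n : ℕ} (c : k) {p : R} (hp : p ∈ F n) : c • p ∈ F n := by
  rw [← algebraMap_smul S c p]
  exact h.smul_mem n _ p hp

theorem exists_constantTerm_mem (M n : ℕ) {p : R} (hp : p ∈ F n) :
    ∃ m, constantTerm k M x y p ∈ F m := by
  obtain ⟨B, hB⟩ := h.exists_union
  rw [← hB]
  refine weylProjList_apply_mem B ?_ ?_ ?_ _ _ ((hB p).2 ⟨n, hp⟩)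
  · intro c g hg
    obtain ⟨m, hm⟩ := (hB g).1 hg
    exact (hB _).2 ⟨m, h.algebra_smul_mem c hm⟩
  · intro i g hg
    obtain ⟨m, hm⟩ := (hB g).1 hg
    exact (hB _).2 ⟨m, sub_mem (h.mul_smul_one_mem (x i) hm) (h.smul_mem m _ g hm)⟩
  · intro i g hg
    obtain ⟨m, hm⟩ := (hB g).1 hg
    exact (hB _).2 ⟨m + 1, h.mul_y_mem m i g hm⟩

theorem exists_rightLinearize_mem (M : ℕ) {φ : S →ₗ[k] R} (hφ : ∀ s, ∃ n, φ s ∈ F n) (s : S) :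
    ∃ m, rightLinearize k M x y φ s ∈ F m := by
  obtain ⟨B, hB⟩ := h.exists_union
  let U : AddSubgroup (S →ₗ[k] R) :=
    { carrier := {φ | ∀ s, φ s ∈ B}
      zero_mem' := fun s => zero_mem _
      add_mem' := fun h1 h2 s => add_mem (h1 s) (h2 s)
      neg_mem' := fun h1 s => neg_mem (h1 s) }
  rw [← hB]
  suffices rightLinearize k M x y φ ∈ U from this s
  refine weylProjList_apply_mem U ?_ ?_ ?_ _ _ fun s => (hB _).2 (hφ s)
  · intro c g hg s
    obtain ⟨m, hm⟩ := (hB _).1 (hg s)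
    exact (hB _).2 ⟨m, h.algebra_smul_mem c hm⟩
  · intro i g hg s
    obtain ⟨m, hm⟩ := (hB _).1 (hg s)
    exact sub_mem (hg _) ((hB _).2 ⟨m, h.mul_smul_one_mem (x i) hm⟩)
  · intro i g hg s
    obtain ⟨m, hm⟩ := (hB _).1 (hg s)
    exact neg_mem ((hB _).2 ⟨m + 1, h.mul_y_mem m i _ hm⟩)

omit h in
theorem iterCommutator_rightLinearize (M N : ℕ) {φ : S →ₗ[k] R}
    (hφ : ∀ fs : List S, fs.length = N → iterCommutator fs φ = 0) (fs : List S)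
    (hfs : fs.length = N) : iterCommutator fs (rightLinearize k M x y φ) = 0 := by
  let U : AddSubgroup (S →ₗ[k] R) := (diffOps S R N).comap
    ({ toFun := fun φ => φ, map_zero' := rfl, map_add' := fun _ _ => rfl } :
      (S →ₗ[k] R) →+ (S → R))
  have hpost (u : Module.End S R) (φ : S →ₗ[k] R) (hφ : φ ∈ U) : postcomp k u φ ∈ U :=
    comp_mem_diffOps u hφ
  suffices rightLinearize k M x y φ ∈ U from this fs hfs
  refine weylProjList_apply_mem U ?_ ?_ ?_ _ _ hφ
  · intro c g hg
    have : c • g = postcomp k (LinearMap.lsmul S R (algebraMap k S c)) g := by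
      ext s
      simp
    rw [this]
    exact hpost _ g hg
  · intro i g hg
    exact U.sub_mem (x := g ∘ₗ LinearMap.mulLeft k (x i)) (comp_mul_mem_diffOps (x i) hg)
      (hpost _ g hg)
  · intro i g hg
    exact neg_mem (hpost _ g hg)

omit h in
/-- On operators whose values commute with `f`, the operator `shiftEnd` is, up to sign, the
commutator with `f`, which lowers the order. -/
theorem shiftEnd_pow_eq_zero (m : ℕ) (f : S) (φ : S →ₗ[k] R)
    (hφ : ∀ fs : List S, fs.length = m → iterCommutator fs φ = 0)
    (hc : postcomp k (commutatorEnd R f) φ = 0) : (shiftEnd k R f ^ m) φ = 0 := by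
  induction m generalizing φ with
  | zero => exact DFunLike.coe_injective (hφ [] rfl)
  | succ m ih =>
    rw [pow_succ, Module.End.mul_apply]
    refine ih _ (fun fs hfs => ?_) ?_
    · have h1 : ⇑(shiftEnd k R f φ) = fun s => (-1 : S) • (f • φ s - φ (f * s)) := by
        ext s
        have h2 := congrArg (fun ψ : S →ₗ[k] R => ψ s) hc
        simp only [postcomp_apply, commutatorEnd_apply, LinearMap.zero_apply, sub_eq_zero] at h2
        rw [shiftEnd_apply, h2]
        simp
      rw [h1]
      refine (iterCommutator_comp_linearMap (LinearMap.lsmul S R (-1)) fs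
        (fun s => f • φ s - φ (f * s))).trans ?_
      rw [← iterCommutator_cons, hφ (f :: fs) (by simp [hfs])]
      ext
      simp
    · rw [← Module.End.mul_apply, (commute_postcomp_commutatorEnd_shiftEnd f f).eq,
        Module.End.mul_apply, hc, map_zero]

/-- The differential operator `s ↦ ε (φ s)`, where `ε` is the constant term, is of the form
`s ↦ ε (p s)`. -/
theorem constantTerm_coinducedLift [CharZero k] (M : ℕ) (φ : S →ₗ[k] R)
    (hφ : ∀ fs : List S, fs.length = M + 1 → iterCommutator fs φ = 0) (hF : ∀ s, φ s ∈ F M)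
    (s : S) : constantTerm k M x y (coinducedLift k M x y φ * (s • 1)) =
      constantTerm k M x y (φ s) := by
  set φ₀ := postcomp k (constantTerm k M x y) φ with hφ₀
  set θ := rightLinearize k M x y φ₀ with hθ
  have hord₀ (fs : List S) (hfs : fs.length = M + 1) : iterCommutator fs φ₀ = 0 := by
    refine (iterCommutator_comp_linearMap (constantTerm k M x y) fs φ).trans ?_
    rw [hφ fs hfs]
    ext
    simp
  have hc₀ (i : Fin d) : postcomp k (commutatorEnd R (x i)) φ₀ = 0 := by
    ext s
    exact h.commutator_constantTerm (hF s) i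
  have hshift (i : Fin d) : shiftEnd k R (x i) θ = 0 := by
    refine apply_weylProjList_eq_zero (fun _ _ => commute_shiftEnd _ _) (fun i => ?_)
      (fun i j hij => ?_) M (List.nodup_finRange d)
      (fun i _ => shiftEnd_pow_eq_zero _ _ _ hord₀ (hc₀ i)) i (List.mem_finRange i)
    · ext φ s
      simp [h.shiftEnd_bracket i i φ, -shiftEnd_apply]
      abel
    · ext φ s
      simp [h.shiftEnd_bracket i j φ, -shiftEnd_apply, hij]
  have hconst (s : S) : constantTerm k M x y (θ s) = φ₀ s := by
    have h1 := weylProjList_weylProjList (k := k)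
      (a := fun i => postcomp k (commutatorEnd R (x i)))
      (b := fun i => postcomp k (LinearMap.mulRight S (y i)))
      (c := fun i => shiftEnd k R (x i))
      (fun i => by
        ext φ s
        exact congrArg (fun w : Module.End S R => w (φ s)) (h.commutator_mul_y i))
      (fun i j hij => commute_postcomp (h.commute_commutator_mul_y hij))
      (fun i j => commute_postcomp_commutatorEnd_shiftEnd _ _) M (List.nodup_finRange d)
      (fun i _ => hc₀ i)
    have h2 := weylProjList_intertwine (k := k)
      (a := fun i => postcomp k (commutatorEnd R (x i)))
      (b := fun i => postcomp k (LinearMap.mulRight S (y i)))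
      (a' := fun i => commutatorEnd R (x i)) (b' := fun i => LinearMap.mulRight S (y i))
      (LinearMap.applyₗ (R := k) (M₂ := R) s) (fun _ _ => rfl) (fun _ _ => rfl) (M + 1)
      (List.finRange d).reverse θ
    exact h2.symm.trans (congrArg (fun ψ : S →ₗ[k] R => ψ s) h1)
  -- `θ` commutes with the right action of the coordinates, hence of all functions, because both
  -- sides are differential operators that agree on monomials.
  have hright (s : S) : θ s = θ 1 * (s • 1) := by
    obtain ⟨n, hn⟩ := h.exists_rightLinearize_mem M
      (fun s => h.exists_constantTerm_mem M M (hF s)) 1 (φ := φ₀)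
    let R₁ : S →ₗ[k] R :=
      { toFun := fun s => θ 1 * (s • 1)
        map_add' := fun s t => by rw [add_smul, mul_add]
        map_smul' := fun c s => by
          rw [smul_assoc, mul_smul_comm, RingHom.id_apply] }
    have hz : θ - R₁ = 0 := by
      refine eq_zero_of_monomials h.span_eq_top (max (M + 1) (n + 1)) _ (fun fs hfs => ?_)
        fun l hl => ?_
      · refine (iterCommutator_sub fs θ R₁).trans ?_
        rw [iterCommutator_eq_zero_of_le (le_max_left _ _)
            (iterCommutator_rightLinearize M (M + 1) hord₀) fs hfs,
          show iterCommutator fs R₁ = 0 from iterCommutator_eq_zero_of_le (le_max_right _ _)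
            (h.iterCommutator_mul n hn) fs hfs, sub_zero]
      · clear hl
        induction l with
        | nil => simp [R₁]
        | cons i l ih =>
          have h1 := congrArg (fun ψ : S →ₗ[k] R => ψ (l.map x).prod) (hshift i)
          simp only [shiftEnd_apply, LinearMap.zero_apply, sub_eq_zero] at h1
          simp only [LinearMap.sub_apply, sub_eq_zero] at ih ⊢
          rw [List.map_cons, List.prod_cons, h1, ih]
          change θ 1 * (_ • 1) * _ = θ 1 * (_ • 1)
          rw [mul_assoc, smul_mul_assoc, one_mul, smul_smul, mul_comm]
    exact congrArg (fun ψ : S →ₗ[k] R => ψ s) (sub_eq_zero.1 hz)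
  rw [coinducedLift_apply, ← hφ₀, ← hθ, ← hright, hconst]
  rfl

end IsLocalModel

end LocalModel

/-! ### The Hochschild differential and its contraction -/

section Tuples

variable {S : Type*}

theorem contractNth_succ_cons [Mul S] {n : ℕ} (i : Fin (n + 1)) (a : S)
    (g : Fin (n + 1) → S) :
    Fin.contractNth i.succ (· * ·) (Fin.cons a g : Fin (n + 2) → S) =
      Fin.cons a (Fin.contractNth i (· * ·) g) := by
  ext l
  induction l using Fin.cases with
  | zero => simp [Fin.contractNth]
  | succ l =>
    simp only [Fin.contractNth, Fin.cons_succ, Fin.val_succ, Nat.add_lt_add_iff_right,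
      Nat.add_right_cancel_iff]
    rfl

theorem contractNth_zero_cons [Mul S] {n : ℕ} (a : S) (g : Fin (n + 1) → S) :
    Fin.contractNth 0 (· * ·) (Fin.cons a g : Fin (n + 2) → S) =
      Fin.cons (a * g 0) (Fin.tail g) := by
  ext l
  induction l using Fin.cases with
  | zero => simp [Fin.contractNth]
  | succ l => simp [Fin.contractNth, Fin.tail]

theorem init_cons {n : ℕ} (a : S) (g : Fin (n + 1) → S) :
    Fin.init (Fin.cons a g : Fin (n + 2) → S) = Fin.cons a (Fin.init g) := by
  ext l
  induction l using Fin.cases with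
  | zero => rfl
  | succ l => rfl

theorem contractNth_castSucc_snoc [Mul S] {n : ℕ} (i : Fin n) (g : Fin (n + 1) → S)
    (s : S) : Fin.contractNth i.castSucc.castSucc (· * ·) (Fin.snoc g s : Fin (n + 2) → S) =
      Fin.snoc (Fin.contractNth i.castSucc (· * ·) g) s := by
  ext l
  induction l using Fin.lastCases with
  | last =>
    have := i.2
    simp only [Fin.contractNth, Fin.snoc_last, Fin.val_castSucc, Fin.val_last]
    rw [if_neg (by omega), if_neg (by omega), Fin.succ_last, Fin.snoc_last]
  | cast l =>
    simp only [Fin.contractNth, Fin.snoc_castSucc, Fin.val_castSucc]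
    have h : l.castSucc.succ = l.succ.castSucc := rfl
    rw [h, Fin.snoc_castSucc]

theorem contractNth_last_snoc [Mul S] {n : ℕ} (g : Fin (n + 1) → S)
    (s : S) : Fin.contractNth (Fin.last n).castSucc (· * ·) (Fin.snoc g s : Fin (n + 2) → S) =
      Fin.snoc (Fin.init g) (g (Fin.last n) * s) := by
  ext l
  induction l using Fin.lastCases with
  | last => simp [Fin.contractNth, Fin.snoc]
  | cast l => simp [Fin.contractNth, Fin.init]

theorem tail_snoc {n : ℕ} (g : Fin (n + 1) → S) (s : S) :
    Fin.tail (Fin.snoc g s : Fin (n + 2) → S) = Fin.snoc (Fin.tail g) s := by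
  ext l
  induction l using Fin.lastCases with
  | last => rw [Fin.tail, Fin.succ_last, Fin.snoc_last, Fin.snoc_last]
  | cast l => simp [Fin.tail, ← Fin.castSucc_succ]

end Tuples

section Bar

variable {S R : Type*} [CommRing S] [Ring R] [Module S R] [IsScalarTower S R R]

/-- The Hochschild differential without its first summand, up to sign:
`∑ᵢ (-1)ⁱ A(…, gᵢ gᵢ₊₁, …) + (-1)ⁿ A(g₀, …, gₙ₋₁) gₙ`. -/
def rightBar {n : ℕ} (A : (Fin n → S) → R) (g : Fin (n + 1) → S) : R :=
  ∑ i : Fin n, (-1 : ℤ) ^ i.1 • A (Fin.contractNth i.castSucc (· * ·) g) +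
    (-1 : ℤ) ^ n • (A (Fin.init g) * (g (Fin.last n) • 1))

/-- The Hochschild differential of a function of `n` arguments. -/
def hochschild {n : ℕ} (A : (Fin n → S) → R) (g : Fin (n + 1) → S) : R :=
  g 0 • A (Fin.tail g) - rightBar A g

omit [IsScalarTower S R R] in
theorem hochschild_eq {n : ℕ} (A : (Fin n → S) → R) (g : Fin (n + 1) → S) :
    hochschild A g = g 0 • A (Fin.tail g) +
      ∑ i : Fin n, (-1 : ℤ) ^ (i.1 + 1) • A (Fin.contractNth i.castSucc (· * ·) g) +
      (-1 : ℤ) ^ (n + 1) • (A (Fin.init g) * (g (Fin.last n) • 1)) := by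
  simp only [hochschild, rightBar, pow_succ, mul_neg, mul_one, neg_smul, Finset.sum_neg_distrib]
  abel

omit [IsScalarTower S R R] in
theorem rightBar_cons {n : ℕ} (A : (Fin (n + 1) → S) → R) (a : S) (g : Fin (n + 1) → S) :
    rightBar A (Fin.cons a g) =
      A (Fin.cons (a * g 0) (Fin.tail g)) - rightBar (fun g => A (Fin.cons a g)) g := by
  rw [rightBar, Fin.sum_univ_succ, rightBar]
  have h (i : Fin n) : Fin.contractNth i.succ.castSucc (· * ·) (Fin.cons a g : Fin (n + 2) → S) =
      Fin.cons a (Fin.contractNth i.castSucc (· * ·) g) := contractNth_succ_cons i.castSucc a g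
  simp only [h, Fin.castSucc_zero, contractNth_zero_cons, init_cons, Fin.val_zero, pow_zero,
    one_smul, Fin.val_succ, pow_succ, mul_neg, mul_one, neg_smul, Finset.sum_neg_distrib,
    ← Fin.succ_last, Fin.cons_succ]
  abel

omit [IsScalarTower S R R] in
theorem rightBar_mul_left {n : ℕ} (A : (Fin (n + 1) → S) → R) (a : S) (g : Fin (n + 2) → S) :
    rightBar (fun g => A (Fin.cons (a * g 0) (Fin.tail g))) g =
      rightBar A (Fin.cons (a * g 0) (Fin.tail g)) := by
  induction g using Fin.consCases with
  | cons b g =>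
    rw [Fin.cons_zero, Fin.tail_cons, rightBar_cons, rightBar_cons]
    simp [mul_assoc]

omit [IsScalarTower S R R] in
theorem rightBar_sub {n : ℕ} (A B : (Fin n → S) → R) (g : Fin (n + 1) → S) :
    rightBar (fun g => A g - B g) g = rightBar A g - rightBar B g := by
  simp only [rightBar, smul_sub, Finset.sum_sub_distrib, sub_mul]
  abel

theorem rightBar_rightBar {n : ℕ} (A : (Fin n → S) → R) (g : Fin (n + 2) → S) :
    rightBar (rightBar A) g = 0 := by
  induction n with
  | zero =>
    have h : Fin.contractNth 0 (· * ·) g = fun _ => g 0 * g 1 := by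
      ext l
      fin_cases l
      simp [Fin.contractNth]
    have h0 (u : Fin 0 → S) : A u = A Fin.elim0 := congrArg A (Subsingleton.elim _ _)
    simp [rightBar, h, mul_assoc, mul_smul, Fin.init, Fin.last, h0 (fun _ => _)]
  | succ n ih =>
    induction g using Fin.consCases with
    | cons a g =>
      rw [rightBar_cons]
      simp only [rightBar_cons]
      rw [← rightBar_cons, rightBar_sub, ih, sub_zero, rightBar_mul_left, sub_self]

theorem hochschild_hochschild {n : ℕ} (A : (Fin n → S) → R) (g : Fin (n + 2) → S) :
    hochschild (hochschild A) g = 0 := by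
  have h : rightBar (fun g : Fin (n + 1) → S => g 0 • A (Fin.tail g)) g =
      g 0 • g 1 • A (Fin.tail (Fin.tail g)) - g 0 • rightBar A (Fin.tail g) := by
    induction g using Fin.consCases with
    | cons a g =>
      rw [rightBar_cons]
      simp only [Fin.cons_zero, Fin.tail_cons, Fin.cons_one]
      rw [mul_smul]
      congr 1
      simp only [rightBar, smul_add, Finset.smul_sum, smul_mul_assoc]
      simp only [smul_comm a (_ : ℤ)]
  unfold hochschild
  rw [rightBar_sub, rightBar_rightBar, h, smul_sub]
  simp [Fin.tail]

end Bar

section Homotopy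

variable {k S R : Type*} [Field k] [CharZero k] [CommRing S] [Algebra k S] [Ring R] [Algebra k R]
  [Module S R] [IsScalarTower k S R] [IsScalarTower S R R] {d : ℕ}
  {F : ℕ → AddSubgroup R} {x : Fin d → S} {y : Fin d → R}

/-- The contracting homotopy of the bar complex: it views a cochain as a function of its first
arguments with values in the differential operators in the last one, and replaces these operators
by elements of `R`. The identity is checked on the constant terms of both sides multiplied by `s`,
where it is the cocycle condition for the arguments `g` and `s`. -/
theorem IsLocalModel.hochschild_coinducedLift (h : IsLocalModel k F x y) {n : ℕ} (M : ℕ)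
    (A : MultilinearMap k (fun _ : Fin (n + 1) => S) R)
    (hA : ∀ (g : Fin n → S) (fs : List S), fs.length = M + 1 →
      iterCommutator fs (fun s => A (Fin.snoc g s)) = 0)
    (hF : ∀ g, A g ∈ F M) (hd : ∀ g, hochschild A g = 0) (g : Fin (n + 1) → S) :
    hochschild (fun g => coinducedLift k M x y (A.curryRight g)) g = (-1 : ℤ) ^ (n + 1) • A g := by
  set B : (Fin n → S) → R := fun g => coinducedLift k M x y (A.curryRight g) with hB
  have hpair (g : Fin n → S) (s : S) : constantTerm k M x y (B g * (s • 1)) =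
      constantTerm k M x y (A (Fin.snoc g s)) :=
    h.constantTerm_coinducedLift M (A.curryRight g) (hA g) (fun s => hF _) s
  obtain ⟨U, hU⟩ := h.exists_union
  have hBU (g : Fin n → S) : B g ∈ U := (hU _).2 <|
    h.exists_rightLinearize_mem M (fun s => h.exists_constantTerm_mem M M (hF _)) 1
  have hsmulU (f : S) {p : R} (hp : p ∈ U) : f • p ∈ U := by
    obtain ⟨m, hm⟩ := (hU _).1 hp
    exact (hU _).2 ⟨m, h.smul_mem m f p hm⟩
  have hmulU (f : S) {p : R} (hp : p ∈ U) : p * (f • 1) ∈ U := by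
    obtain ⟨m, hm⟩ := (hU _).1 hp
    exact (hU _).2 ⟨m, h.mul_smul_one_mem f hm⟩
  obtain ⟨m, hm⟩ := (hU (hochschild B g - (-1 : ℤ) ^ (n + 1) • A g)).1 <| by
    refine sub_mem (sub_mem (hsmulU _ (hBU _)) (add_mem (sum_mem fun i _ => ?_) ?_)) ?_
    · exact zsmul_mem (hBU _) _
    · exact zsmul_mem (hmulU _ (hBU _)) _
    · exact zsmul_mem ((hU _).2 ⟨M, hF g⟩) _
  refine sub_eq_zero.1 (h.eq_zero_of_constantTerm M m hm fun s => ?_)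
  have h1 := congrArg (constantTerm k M x y) (hd (Fin.snoc g s))
  rw [hochschild_eq, Fin.sum_univ_castSucc] at h1
  simp only [contractNth_castSucc_snoc, contractNth_last_snoc, tail_snoc, Fin.init_snoc,
    Fin.snoc_last, map_add, map_smul, map_sum, map_zsmul, map_zero, ← hpair, Fin.val_castSucc,
    Fin.val_last] at h1
  have h0 : (Fin.snoc g s : Fin (n + 2) → S) 0 = g 0 := by
    rw [← Fin.castSucc_zero, Fin.snoc_castSucc]
  rw [h0] at h1
  rw [hochschild_eq, sub_mul, add_mul, add_mul, Finset.sum_mul]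
  simp only [smul_mul_assoc, map_sub, map_add, map_smul, map_sum, map_zsmul, mul_assoc, one_mul,
    smul_smul]
  rw [pow_succ _ (n + 1), mul_neg_one, neg_smul, ← sub_eq_add_neg] at h1
  simpa [add_assoc] using h1

end Homotopy

/-! ### Orders and compatibility with restriction -/

section Order

variable {S R : Type*} [CommRing S]

theorem exists_contractNth_update_mul {n : ℕ} (j : Fin n) (g : Fin (n + 1) → S) (i : Fin (n + 1)) :
    ∃ (m : Fin n) (b : S), ∀ s, Fin.contractNth j.castSucc (· * ·) (Function.update g i s) =
      Function.update (Fin.contractNth j.castSucc (· * ·) g) m (b * s) := by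
  rcases lt_trichotomy (i : ℕ) j with h | h | h
  · refine ⟨⟨i, by omega⟩, 1, fun x => ?_⟩
    ext l
    simp only [Fin.contractNth, Function.update_apply, Fin.ext_iff, one_mul]
    grind
  · refine ⟨j, g j.succ, fun x => ?_⟩
    ext l
    by_cases hl : l = j
    · subst hl
      have : i = l.castSucc := Fin.ext h
      subst this
      simp [Fin.contractNth, Fin.ext_iff, mul_comm]
    · have : (l : ℕ) ≠ j := fun h => hl (Fin.ext h)
      simp only [Fin.contractNth, Function.update_apply, Fin.ext_iff]
      grind
  · by_cases h' : (i : ℕ) = j + 1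
    · refine ⟨j, g j.castSucc, fun x => ?_⟩
      ext l
      by_cases hl : l = j
      · subst hl
        have : i = l.succ := Fin.ext h'
        subst this
        simp [Fin.contractNth, Fin.ext_iff]
      · have : (l : ℕ) ≠ j := fun h => hl (Fin.ext h)
        simp only [Fin.contractNth, Function.update_apply, Fin.ext_iff]
        grind
    · refine ⟨⟨i - 1, by omega⟩, 1, fun x => ?_⟩
      ext l
      simp only [Fin.contractNth, Function.update_apply, Fin.ext_iff, one_mul]
      grind

variable [Ring R] [Module S R] [IsScalarTower S R R]

/-- The Hochschild differential preserves multidifferential operators with values in a bounded part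
of the filtration. The bound on the values is what controls the order in the last argument. -/
theorem hochschild_update_mem_diffOps {F : ℕ → AddSubgroup R}
    (hF : ∀ n (f : S), ∀ p ∈ F (n + 1), commutatorEnd R f p ∈ F n)
    (hF0 : ∀ (f : S), ∀ p ∈ F 0, commutatorEnd R f p = 0) {n m M : ℕ} (hm : m < M)
    (A : (Fin n → S) → R)
    (hA : ∀ j g, (fun s => A (Function.update g j s)) ∈ diffOps S R M)
    (hAF : ∀ g, A g ∈ F m) (i : Fin (n + 1)) (g : Fin (n + 1) → S) :
    (fun s => hochschild A (Function.update g i s)) ∈ diffOps S R M := by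
  refine sub_mem (H := diffOps S R M)
    (x := fun s => Function.update g i s 0 • A (Fin.tail (Function.update g i s)))
    (y := fun s => rightBar A (Function.update g i s)) ?_ ?_
  · induction i using Fin.cases with
    | zero =>
      simp only [Function.update_self, Fin.tail_update_zero]
      intro fs hfs
      obtain ⟨f, fs, rfl⟩ := List.exists_cons_of_ne_nil (l := fs) (by
        rintro rfl
        simp at hfs
        omega)
      rw [iterCommutator_cons]
      simp only [smul_smul, sub_self]
      exact iterCommutator_zero fs
    | succ i =>
      simp only [Fin.tail_update_succ, Function.update_of_ne (Fin.succ_ne_zero i).symm]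
      exact comp_mem_diffOps (LinearMap.lsmul S R (g 0)) (hA i _)
  refine add_mem (M := S → R) (S := AddSubgroup (S → R)) (s := diffOps S R M)
    (a := fun s => ∑ j : Fin n, (-1 : ℤ) ^ j.1 •
      A (Fin.contractNth j.castSucc (· * ·) (Function.update g i s)))
    (b := fun s => (-1 : ℤ) ^ n • (A (Fin.init (Function.update g i s)) *
      (Function.update g i s (Fin.last n) • 1))) ?_ ?_
  · have : (fun s => ∑ j : Fin n, (-1 : ℤ) ^ j.1 •
        A (Fin.contractNth j.castSucc (· * ·) (Function.update g i s))) =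
        ∑ j : Fin n, (-1 : ℤ) ^ j.1 •
          fun s => A (Fin.contractNth j.castSucc (· * ·) (Function.update g i s)) := by
      ext s
      simp
    rw [this]
    refine sum_mem fun j _ => zsmul_mem ?_ _
    obtain ⟨l, b, hb⟩ := exists_contractNth_update_mul j g i
    simp only [hb]
    exact comp_mul_mem_diffOps b (hA l _)
  · refine zsmul_mem (S := AddSubgroup (S → R)) (K := diffOps S R M)
      (x := fun s => A (Fin.init (Function.update g i s)) *
        (Function.update g i s (Fin.last n) • 1)) ?_ _
    induction i using Fin.lastCases with
    | last =>
      simp only [Function.update_self, Fin.init_update_last]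
      exact iterCommutator_eq_zero_of_le hm fun fs hfs =>
        iterCommutator_mul_eq_zero hF hF0 m (hAF _) fs hfs
    | cast i =>
      simp only [Fin.init_update_castSucc, Function.update_of_ne (i.castSucc_lt_last.ne')]
      exact comp_mem_diffOps (LinearMap.mulRight S (g (Fin.last n) • (1 : R))) (hA i _)

end Order

section Naturality

variable {k S R S' R' : Type*} [Field k] [CommRing S] [Algebra k S] [Ring R]
  [Algebra k R] [Module S R] [IsScalarTower k S R] [IsScalarTower S R R]
  [CommRing S'] [Algebra k S'] [Ring R']
  [Algebra k R'] [Module S' R'] [IsScalarTower k S' R'] [IsScalarTower S' R' R']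

/-- Homomorphisms of algebras, in particular restrictions of sections, preserve `coinducedLift`. -/
theorem map_coinducedLift {d : ℕ} (M : ℕ) (x : Fin d → S) (y : Fin d → R) (α : S →ₐ[k] S')
    (β : R →ₐ[k] R') (hβ : ∀ s r, β (s • r) = α s • β r) (φ : S →ₗ[k] R) (φ' : S' →ₗ[k] R')
    (h : ∀ s, β (φ s) = φ' (α s)) :
    β (coinducedLift k M x y φ) =
      coinducedLift k M (fun i => α (x i)) (fun i => β (y i)) φ' := by
  -- Both cochains are compared in the space of `k`-linear maps from `S` to `R'`.
  let a' (i : Fin d) : Module.End k (S →ₗ[k] R') :=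
    { toFun := fun ψ => ψ ∘ₗ LinearMap.mulLeft k (x i) -
        LinearMap.mulRight k (α (x i) • (1 : R')) ∘ₗ ψ
      map_add' := fun _ _ => LinearMap.ext fun _ => by simp [add_mul]; abel
      map_smul' := fun _ _ => LinearMap.ext fun _ => by simp [smul_sub] }
  let b' (i : Fin d) : Module.End k (S →ₗ[k] R') :=
    { toFun := fun ψ => -(LinearMap.mulRight k (β (y i)) ∘ₗ ψ)
      map_add' := fun _ _ => LinearMap.ext fun _ => by simp [add_mul]; abel
      map_smul' := fun _ _ => LinearMap.ext fun _ => by simp }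
  let t : (S →ₗ[k] R) →ₗ[k] (S →ₗ[k] R') := LinearMap.compRight k β.toLinearMap
  let t' : (S' →ₗ[k] R') →ₗ[k] (S →ₗ[k] R') := LinearMap.lcomp k R' α.toLinearMap
  have hε (r : R) : β (constantTerm k M x y r) =
      constantTerm k M (fun i => α (x i)) (fun i => β (y i)) (β r) :=
    weylProjList_intertwine β.toLinearMap
      (fun i g => by simp [commutatorEnd_apply, hβ]) (fun i g => by simp) _ _ r
  have h1 := weylProjList_intertwine (a := fun i => shiftEnd k R (x i))
    (b := fun i => -postcomp k (LinearMap.mulRight S (y i))) (a' := a') (b' := b') t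
    (fun i g => LinearMap.ext fun s => by simp [t, a', hβ])
    (fun i g => LinearMap.ext fun s => by simp [t, b']) (M + 1) (List.finRange d)
    (postcomp k (constantTerm k M x y) φ)
  have h2 := weylProjList_intertwine (a := fun i => shiftEnd k R' (α (x i)))
    (b := fun i => -postcomp k (LinearMap.mulRight S' (β (y i)))) (a' := a') (b' := b') t'
    (fun i g => LinearMap.ext fun s => by simp [t', a'])
    (fun i g => LinearMap.ext fun s => by simp [t', b']) (M + 1) (List.finRange d)
    (postcomp k (constantTerm k M (fun i => α (x i)) (fun i => β (y i))) φ')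
  have h3 : t (postcomp k (constantTerm k M x y) φ) =
      t' (postcomp k (constantTerm k M (fun i => α (x i)) (fun i => β (y i))) φ') :=
    LinearMap.ext fun s => by simp [t, t', hε, h]
  have h4 := congrArg (fun ψ : S →ₗ[k] R' => ψ 1) (h1.trans ((congrArg _ h3).trans h2.symm))
  refine h4.trans ?_
  simp [t', coinducedLift_apply, rightLinearize]

end Naturality

/-! ### Sheaves of algebras with a filtration and local coordinates -/

section Sheaf

variable {k : Type u} [Field k] {X : Scheme.{u}} [X.Over (Spec (.of k))]

theorem fres_fres {V W Z : X.Opens} (h : W ≤ V) (h' : Z ≤ W) (f : Γ(X, V)) :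
    fres h' (fres h f) = fres (h'.trans h) f :=
  (congrArg (fun φ => φ.hom f) (X.presheaf.map_comp (homOfLE h).op (homOfLE h').op)).symm

theorem fres_constants {V W : X.Opens} (h : W ≤ V) (c : k) :
    fres h (constants k X V c) = constants k X W c :=
  fres_fres (le_top : V ≤ ⊤) h _

variable (k) in
/-- Restriction of functions as a homomorphism of `k`-algebras. -/
def fresAlg {V W : X.Opens} (h : W ≤ V) : Γ(X, V) →ₐ[k] Γ(X, W) :=
  { fres h with commutes' := fun c => fres_constants h c }

namespace AlgebraSheaf

variable (P : AlgebraSheaf k X)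

/-- The left action of functions on sections of `P`. -/
instance secModule (U : X.Opens) : Module Γ(X, U) (P.sec U) := Module.compHom _ (P.ι U)

theorem smul_def {U : X.Opens} (f : Γ(X, U)) (p : P.sec U) : f • p = P.ι U f * p := rfl

theorem smul_one_eq {U : X.Opens} (f : Γ(X, U)) : f • (1 : P.sec U) = P.ι U f := mul_one _

instance secScalarTower (U : X.Opens) : IsScalarTower Γ(X, U) (P.sec U) (P.sec U) :=
  ⟨fun f p q => mul_assoc (P.ι U f) p q⟩

instance constantsScalarTower (U : X.Opens) : IsScalarTower k Γ(X, U) (P.sec U) :=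
  ⟨fun c f p => by
    rw [smul_def, P.ι_smul, smul_mul_assoc]
    rfl⟩

theorem commutatorEnd_eq {U : X.Opens} (f : Γ(X, U)) (p : P.sec U) :
    commutatorEnd (P.sec U) f p = p * P.ι U f - P.ι U f * p := by
  rw [commutatorEnd_apply, smul_one_eq, smul_def]

theorem iterComm_eq {U : X.Opens} (fs : List Γ(X, U)) (φ : Γ(X, U) → P.sec U) :
    P.iterComm fs φ = iterCommutator fs φ := rfl

theorem res_res {V W Z : X.Opens} (h : W ≤ V) (h' : Z ≤ W) (p : P.sec V) :
    P.res h' (P.res h p) = P.res (h'.trans h) p :=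
  (congrArg (fun φ => φ.hom p) (P.sheaf.obj.map_comp (homOfLE h).op (homOfLE h').op)).symm

theorem res_self {V : X.Opens} (p : P.sec V) : P.res le_rfl p = p :=
  congrArg (fun φ => φ.hom p) (P.sheaf.obj.map_id (op V))

theorem res_smul {V W : X.Opens} (h : W ≤ V) (f : Γ(X, V)) (p : P.sec V) :
    P.res h (f • p) = fres h f • P.res h p := by
  rw [smul_def, map_mul, res_ι, smul_def]

theorem res_commutator {V W : X.Opens} (h : W ≤ V) (f : Γ(X, V)) (p : P.sec V) :
    P.res h (commutatorEnd (P.sec V) f p) = commutatorEnd (P.sec W) (fres h f) (P.res h p) := by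
  rw [commutatorEnd_eq, commutatorEnd_eq, map_sub, map_mul, map_mul, res_ι]

/-- Restriction of sections of `P` as a homomorphism of `k`-algebras. -/
def resAlg {V W : X.Opens} (h : W ≤ V) : P.sec V →ₐ[k] P.sec W :=
  { P.res h with
    commutes' := fun c => by
      change P.res h (P.ι V (constants k X V c)) = P.ι W (constants k X W c)
      rw [res_ι, fres_constants] }

theorem eq_of_locally_eq {U : X.Opens} {p q : P.sec U}
    (h : ∀ x ∈ U, ∃ (V : X.Opens) (hV : V ≤ U), x ∈ V ∧ P.res hV p = P.res hV q) : p = q := by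
  choose V hV hxV hpq using h
  exact P.sheaf.eq_of_locally_eq' (fun x : U => V x.1 x.2) U (fun x => homOfLE (hV x.1 x.2))
    (fun x hx => Opens.mem_iSup.2 ⟨⟨x, hx⟩, hxV x hx⟩) p q fun x => hpq x.1 x.2

/-- If `𝒪 → P` is injective, a section of `P` that locally is a function is a function. -/
theorem mem_range_ι_of_locally (hι : ∀ U, Function.Injective (P.ι U)) {U : X.Opens} {p : P.sec U}
    (h : ∀ x ∈ U, ∃ (V : X.Opens) (hV : V ≤ U), x ∈ V ∧ P.res hV p ∈ Set.range (P.ι V)) :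
    p ∈ Set.range (P.ι U) := by
  choose V hV hxV f hf using h
  obtain ⟨g, hg, -⟩ := X.sheaf.existsUnique_gluing' (fun x : U => V x.1 x.2) U
    (fun x => homOfLE (hV x.1 x.2)) (fun x hx => Opens.mem_iSup.2 ⟨⟨x, hx⟩, hxV x hx⟩)
    (fun x => f x.1 x.2) (fun x y => hι _ <| by
      change P.ι _ (fres inf_le_left _) = P.ι _ (fres inf_le_right _)
      rw [← res_ι, ← res_ι, hf, hf, res_res, res_res])
  refine ⟨g, P.eq_of_locally_eq fun x hx => ⟨V x hx, hV x hx, hxV x hx, ?_⟩⟩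
  refine (P.res_ι _ g).trans (Eq.trans ?_ (hf x hx))
  exact congrArg _ (hg ⟨x, hx⟩)

section PolyMap

variable {P} {U : X.Opens} {n : ℕ}

theorem PolyMap.d_map_eq (A : P.PolyMap U n) (V : X.Opens) (hV : V ≤ U)
    (g : Fin (n + 1) → Γ(X, V)) : A.d.map V hV g = hochschild (A.map V hV) g := by
  rw [PolyMap.d_map, hochschild_eq, smul_one_eq]
  rfl

theorem PolyMap.ext_map {A B : P.PolyMap U n}
    (h : ∀ (V : X.Opens) (hV : V ≤ U) (g : Fin n → Γ(X, V)), A.map V hV g = B.map V hV g) :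
    A = B :=
  PolyMap.ext (funext fun V => funext fun hV => MultilinearMap.ext (h V hV))

theorem PolyMap.d_d (A : P.PolyMap U n) : A.d.d = 0 := by
  refine PolyMap.ext_map fun V hV g => ?_
  have h : ⇑(A.d.map V hV) = hochschild (A.map V hV) := funext fun g => A.d_map_eq V hV g
  rw [PolyMap.d_map_eq, h, hochschild_hochschild]
  rfl

theorem PolyMap.d_add (A B : P.PolyMap U n) : (A + B).d = A.d + B.d := by
  refine PolyMap.ext_map fun V hV g => ?_
  change _ = A.d.map V hV g + B.d.map V hV g
  have h (g : Fin n → Γ(X, V)) : (A + B).map V hV g = A.map V hV g + B.map V hV g := rfl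
  simp only [PolyMap.d_map, h, mul_add, add_mul, smul_add, Finset.sum_add_distrib]
  abel

theorem PolyMap.d_zsmul (m : ℤ) (A : P.PolyMap U n) : (m • A).d = m • A.d :=
  map_zsmul (AddMonoidHom.mk' PolyMap.d PolyMap.d_add : P.PolyMap U n →+ P.PolyMap U (n + 1)) m A

theorem PolyMap.d_restrict (A : P.PolyMap U n) {V : X.Opens} (hV : V ≤ U) :
    (A.restrict hV).d = A.d.restrict hV := by
  refine PolyMap.ext_map fun W hW g => ?_
  rw [PolyMap.d_map]
  exact (A.d_map W (hW.trans hV) g).symm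

theorem PolyMap.eq_of_locally_eq {A B : P.PolyMap U n} (h : ∀ (W : X.Opens), W ≤ U → ∀ w ∈ W,
    ∃ W' ≤ W, w ∈ W' ∧ ∀ (h' : W' ≤ U) (g : Fin n → Γ(X, W')), A.map W' h' g = B.map W' h' g) :
    A = B := by
  refine PolyMap.ext_map fun W hW g => P.eq_of_locally_eq fun w hw => ?_
  obtain ⟨W', hW', hw', hAB⟩ := h W hW w hw
  exact ⟨W', hW', hw', by rw [PolyMap.map_res, PolyMap.map_res, hAB]⟩

theorem PolyMap.isPolyDiff_of_hasOrderLE {A : P.PolyMap U n} {N : Fin n → ℕ}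
    (h : A.HasOrderLE N) : A.IsPolyDiff := fun _ hx => ⟨U, le_rfl, hx, N, h⟩

end PolyMap

/-- A filtration by subsheaves that is exhaustive and multiplicative, starts with functions, and is
lowered by commutators with functions. -/
structure IsGoodFiltration (F : ℕ → ∀ U : X.Opens, AddSubgroup (P.sec U)) : Prop where
  res_mem : ∀ n {V W : X.Opens} (h : W ≤ V), ∀ p ∈ F n V, P.res h p ∈ F n W
  mem_of_locally : ∀ n (U : X.Opens) (p : P.sec U),
    (∀ x ∈ U, ∃ (V : X.Opens) (h : V ≤ U), x ∈ V ∧ P.res h p ∈ F n V) → p ∈ F n U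
  mono : ∀ U, Monotone fun n => F n U
  mul_mem : ∀ m n U, ∀ p ∈ F m U, ∀ q ∈ F n U, p * q ∈ F (m + n) U
  exhaustive : ∀ (U : X.Opens) (p : P.sec U), ∀ x ∈ U,
    ∃ (V : X.Opens) (h : V ≤ U), x ∈ V ∧ ∃ n, P.res h p ∈ F n V
  ι_mem : ∀ (U : X.Opens) (f : Γ(X, U)), P.ι U f ∈ F 0 U
  commutator_mem : ∀ n U (f : Γ(X, U)), ∀ p ∈ F (n + 1) U, commutatorEnd (P.sec U) f p ∈ F n U
  commutator_zero : ∀ U (f : Γ(X, U)), ∀ p ∈ F 0 U, commutatorEnd (P.sec U) f p = 0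

/-- Coordinates on an open set `V`: functions whose differentials span the Kähler differentials on a
basis of open sets, together with sections of `P` of filtration at most `1` that are dual to them,
such that a section of `P` that commutes with the coordinates locally is a function. -/
structure IsCoordinates (F : ℕ → ∀ U : X.Opens, AddSubgroup (P.sec U)) (V : X.Opens) {d : ℕ}
    (x : Fin d → Γ(X, V)) (y : Fin d → P.sec V) : Prop where
  y_mem : ∀ i, y i ∈ F 1 V
  commutator_y : ∀ i j, commutatorEnd (P.sec V) (x i) (y j) = if i = j then 1 else 0
  central : ∀ (W : X.Opens) (hW : W ≤ V) (p : P.sec W),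
    (∀ i, commutatorEnd (P.sec W) (fres hW (x i)) p = 0) → ∀ w ∈ W,
      ∃ (W' : X.Opens) (h : W' ≤ W), w ∈ W' ∧ P.res h p ∈ Set.range (P.ι W')
  span_eq_top : ∀ W ≤ V, ∀ w ∈ W, ∃ W' ≤ W, w ∈ W' ∧ ∀ h : W' ≤ V,
    Submodule.span Γ(X, W')
      (Set.range fun i => KaehlerDifferential.D k Γ(X, W') (fres h (x i))) = ⊤

variable {P} {F : ℕ → ∀ U : X.Opens, AddSubgroup (P.sec U)} (hF : P.IsGoodFiltration F)

include hF

theorem IsGoodFiltration.smul_mem {n : ℕ} {U : X.Opens} (f : Γ(X, U)) {p : P.sec U}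
    (hp : p ∈ F n U) : f • p ∈ F n U := by
  rw [smul_def]
  simpa using hF.mul_mem 0 n U _ (hF.ι_mem U f) p hp

theorem IsCoordinates.restrict {V W : X.Opens} {d : ℕ} {x : Fin d → Γ(X, V)} {y : Fin d → P.sec V}
    (h : P.IsCoordinates F V x y) (hW : W ≤ V) :
    P.IsCoordinates F W (fun i => fres hW (x i)) (fun i => P.res hW (y i)) where
  y_mem i := hF.res_mem 1 hW _ (h.y_mem i)
  commutator_y i j := by
    rw [← res_commutator, h.commutator_y]
    split_ifs <;> simp
  central W' hW' p hp := h.central W' (hW'.trans hW) p fun i => by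
    rw [← fres_fres hW hW']
    exact hp i
  span_eq_top W' hW' w hw := by
    obtain ⟨W'', hW'', hw', hspan⟩ := h.span_eq_top W' (hW'.trans hW) w hw
    refine ⟨W'', hW'', hw', fun h' => ?_⟩
    simp only [fres_fres]
    exact hspan _

theorem IsCoordinates.isLocalModel {V : X.Opens} {d : ℕ} {x : Fin d → Γ(X, V)}
    {y : Fin d → P.sec V} (h : P.IsCoordinates F V x y) {W : X.Opens} (hW : W ≤ V)
    (hspan : Submodule.span Γ(X, W)
      (Set.range fun i => KaehlerDifferential.D k Γ(X, W) (fres hW (x i))) = ⊤) :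
    IsLocalModel k (fun n => F n W) (fun i => fres hW (x i)) (fun i => P.res hW (y i)) where
  span_eq_top := hspan
  commutator_y := (h.restrict hF hW).commutator_y
  mono := hF.mono W
  smul_mem _ f _ := hF.smul_mem f
  commutator_mem n f p hp := hF.commutator_mem n W f p hp
  commutator_zero f p hp := hF.commutator_zero W f p hp
  mul_y_mem n i p hp := hF.mul_mem n 1 W p hp _ (hF.res_mem 1 hW _ (h.y_mem i))

/-- Locally, finitely many sections lie in the same step of the filtration. -/
theorem IsGoodFiltration.exists_forall_mem {U : X.Opens} {w : X} (hw : w ∈ U) {σ : Type*}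
    (s : Finset σ) (p : σ → P.sec U) : ∃ (V : X.Opens) (h : V ≤ U), w ∈ V ∧ ∃ m,
      ∀ i ∈ s, P.res h (p i) ∈ F m V := by
  classical
  induction s using Finset.induction with
  | empty => exact ⟨U, le_rfl, hw, 0, by simp⟩
  | insert i s hi ih =>
    obtain ⟨V, hV, hwV, m, hm⟩ := ih
    obtain ⟨V', hV', hwV', m', hm'⟩ := hF.exhaustive U (p i) w hw
    refine ⟨V ⊓ V', inf_le_left.trans hV, ⟨hwV, hwV'⟩, max m m', fun j hj => ?_⟩
    rcases Finset.mem_insert.1 hj with rfl | hj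
    · rw [← P.res_res hV' inf_le_right]
      exact hF.res_mem _ _ _ (hF.mono _ (le_max_right _ _) hm')
    · rw [← P.res_res hV inf_le_left]
      exact hF.res_mem _ _ _ (hF.mono _ (le_max_left _ _) (hm j hj))

/-- A polydifferential operator locally takes values in a step of the filtration, because it is
determined by its values on finitely many monomials in the coordinates. -/
theorem IsCoordinates.exists_bound {U V : X.Opens} {d : ℕ} {x : Fin d → Γ(X, V)}
    {y : Fin d → P.sec V} (h : P.IsCoordinates F V x y) {n : ℕ} {A : P.PolyMap U n}
    (hA : A ∈ P.Diff U n) {w : X} (hwU : w ∈ U) (hwV : w ∈ V) :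
    ∃ (V' : X.Opens) (hU : V' ≤ U), V' ≤ V ∧ w ∈ V' ∧ ∃ M,
      (A.restrict hU).HasOrderLE (fun _ => M) ∧
      ∀ (W : X.Opens) (hW : W ≤ V') (g : Fin n → Γ(X, W)), A.map W (hW.trans hU) g ∈ F M W := by
  obtain ⟨V₁, hV₁, hwV₁, N, hN⟩ := hA w hwU
  obtain ⟨K, hK⟩ : ∃ K, ∀ j, N j ≤ K :=
    ⟨Finset.univ.sup N, fun j => Finset.le_sup (Finset.mem_univ j)⟩
  set V₂ := V₁ ⊓ V with hV₂
  have hV₂U : V₂ ≤ U := inf_le_left.trans hV₁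
  have hV₂V : V₂ ≤ V := inf_le_right
  have hfin : {l : Fin n → List (Fin d) | ∀ j, (l j).length < K + 1}.Finite := by
    have := Set.Finite.pi (t := fun _ : Fin n => {l : List (Fin d) | l.length < K + 1})
      fun _ => List.finite_length_lt _ _
    exact this.subset fun l hl j _ => hl j
  obtain ⟨V₃, hV₃, hwV₃, m, hm⟩ := hF.exists_forall_mem (U := V₂) ⟨hwV₁, hwV⟩ hfin.toFinset
    (fun l => A.map V₂ hV₂U fun j => ((l j).map fun i => fres hV₂V (x i)).prod)
  have hV₃V₁ : V₃ ≤ V₁ := hV₃.trans inf_le_left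
  have hord : (A.restrict (hV₃.trans hV₂U)).HasOrderLE (fun _ => K) := fun W hW j g fs hfs =>
    hN.mono (M := fun _ => K) hK W (hW.trans hV₃V₁) j g fs hfs
  have hval (W : X.Opens) (hW : W ≤ V₃) (g : Fin n → Γ(X, W)) :
      A.map W (hW.trans (hV₃.trans hV₂U)) g ∈ F m W := by
    refine hF.mem_of_locally m W _ fun z hz => ?_
    obtain ⟨W', hW', hz', hspan⟩ := h.span_eq_top W (hW.trans (hV₃.trans hV₂V)) z hz
    refine ⟨W', hW', hz', ?_⟩
    rw [PolyMap.map_res]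
    have hW'₃ : W' ≤ V₃ := hW'.trans hW
    let S : Submodule Γ(X, W') (P.sec W') :=
      { F m W' with smul_mem' := fun f p hp => hF.smul_mem f hp }
    let B : MultilinearMap k (fun _ : Fin n => Γ(X, W')) (P.sec W' ⧸ S) :=
      (S.mkQ.restrictScalars k).compMultilinearMap (A.map W' (hW'₃.trans (hV₃.trans hV₂U)))
    -- The values on monomials lie in `S`, and `B` is `A` modulo `S`.
    have hB : B = 0 := by
      refine multilinearMap_eq_zero_of_monomials (hspan (hW'₃.trans (hV₃.trans hV₂V)))
        (fun _ => K + 1) B (fun j g fs hfs => ?_) fun l hl => ?_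
      · refine (iterCommutator_comp_linearMap S.mkQ fs _).trans ?_
        have := hord W' hW'₃ j g fs hfs
        rw [iterComm_eq] at this
        ext s
        exact (congrArg S.mkQ (congrFun this s)).trans (map_zero _)
      · refine (Submodule.Quotient.mk_eq_zero S).2 ?_
        change A.map W' _ _ ∈ F m W'
        have := hF.res_mem m hW'₃ _ (hm l (hfin.mem_toFinset.2 hl))
        rw [res_res, PolyMap.map_res] at this
        convert! this using 2
        ext j
        rw [map_list_prod, List.map_map]
        congr 2
        ext i
        exact (fres_fres _ _ _).symm
    have := congrArg (fun C : MultilinearMap k (fun _ : Fin n => Γ(X, W')) (P.sec W' ⧸ S) =>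
      C fun i => fres hW' (g i)) hB
    exact (Submodule.Quotient.mk_eq_zero S).1 this
  refine ⟨V₃, hV₃.trans hV₂U, hV₃.trans hV₂V, hwV₃, max K m, hord.mono fun _ => le_max_left _ _,
    fun W hW g => hF.mono W (le_max_right _ _) (hval W hW g)⟩

end AlgebraSheaf

end Sheaf

/-! ### The complex of polydifferential operators -/

namespace AlgebraSheaf

variable {k : Type u} [Field k] {X : Scheme.{u}} [X.Over (Spec (.of k))] {P : AlgebraSheaf k X}

theorem commutatorEnd_eq_zero_iff {U : X.Opens} (f : Γ(X, U)) (p : P.sec U) :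
    commutatorEnd (P.sec U) f p = 0 ↔ P.ι U f * p = p * P.ι U f := by
  rw [commutatorEnd_eq, sub_eq_zero, eq_comm]

theorem mem_centralizer_iff {U : X.Opens} {p : P.sec U} : p ∈ P.centralizer U ↔
    ∀ (V : X.Opens) (h : V ≤ U) (f : Γ(X, V)), P.ι V f * P.res h p = P.res h p * P.ι V f := by
  simp [centralizer, Subring.mem_iInf, Subring.mem_centralizer_iff]

theorem mem_H0_iff {U : X.Opens} {p : P.sec U} : p ∈ P.H0 U ↔
    ∀ (V : X.Opens) (h : V ≤ U) (f : Γ(X, V)), P.ι V f * P.res h p = P.res h p * P.ι V f := by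
  have key (V : X.Opens) (h : V ≤ U) (g : Fin 1 → Γ(X, V)) :
      (PolyMap.ofSection (P := P) U p).d.map V h g =
        P.ι V (g 0) * P.res h p - P.res h p * P.ι V (g 0) := by
    rw [PolyMap.d_map]
    simp [PolyMap.ofSection, sub_eq_add_neg]
  constructor
  · intro hp V h f
    have h1 : (PolyMap.ofSection (P := P) U p).d = 0 := hp
    have h2 := key V h fun _ => f
    rw [h1] at h2
    exact sub_eq_zero.1 h2.symm
  · intro hp
    refine PolyMap.ext_map fun V h g => ?_
    rw [key, hp V h, sub_self]
    rfl

theorem H0_eq_centralizer (U : X.Opens) : P.H0 U = P.centralizer U :=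
  Set.ext fun _ => mem_H0_iff.trans mem_centralizer_iff.symm

/-- The homotopy of `IsLocalModel.hochschild_coinducedLift` as an operation on maps of sheaves. -/
noncomputable def PolyMap.homotopy {V : X.Opens} {d : ℕ} (M : ℕ) (x : Fin d → Γ(X, V))
    (y : Fin d → P.sec V) {n : ℕ} (A : P.PolyMap V (n + 1)) : P.PolyMap V n where
  map W hW := ((coinducedLift k M (fun i => fres hW (x i)) fun i => P.res hW (y i)).restrictScalars
    k).compMultilinearMap (A.map W hW).curryRight
  map_res W W' hW hW' g := by
    have h := map_coinducedLift (k := k) M (fun i => fres hW (x i)) (fun i => P.res hW (y i))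
      (fresAlg k hW') (P.resAlg hW') (P.res_smul hW') ((A.map W hW).curryRight g)
      ((A.map W' (hW'.trans hW)).curryRight fun i => fres hW' (g i)) fun s => by
        refine (A.map_res W W' hW hW' _).trans ?_
        rw [MultilinearMap.curryRight_apply]
        congr 1
        ext j
        induction j using Fin.lastCases with
        | last => simp only [Fin.snoc_last]; rfl
        | cast j => simp only [Fin.snoc_castSucc]
    refine h.trans ?_
    change coinducedLift k M (fun i => fres hW' (fres hW (x i)))
      (fun i => P.res hW' (P.res hW (y i))) _ = _
    simp only [fres_fres, res_res]
    rfl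

theorem PolyMap.HasOrderLE.homotopy {V : X.Opens} {d : ℕ} (M : ℕ) (x : Fin d → Γ(X, V))
    (y : Fin d → P.sec V) {n K : ℕ} {A : P.PolyMap V (n + 1)} (hA : A.HasOrderLE fun _ => K) :
    (A.homotopy M x y).HasOrderLE fun _ => K := by
  intro W hW j g fs hfs
  have h1 : iterCommutator fs (fun s => (A.map W hW).curryRight (Function.update g j s)) = 0 := by
    ext t s
    have h2 := iterCommutator_comp_linearMap (N := Γ(X, W) →ₗ[k] P.sec W)
      (LinearMap.applyₗ' Γ(X, W) s) fs
      (fun s => (A.map W hW).curryRight (Function.update g j s))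
    refine (congrFun h2 t).symm.trans ?_
    have h3 := hA W hW j.castSucc (Fin.snoc g s) fs hfs
    simp only [← Fin.snoc_update] at h3
    exact congrFun h3 t
  refine (iterCommutator_comp_linearMap (coinducedLift k M _ _) fs
    (fun s => (A.map W hW).curryRight (Function.update g j s))).trans ?_
  rw [h1]
  ext
  exact map_zero _

variable {F : ℕ → ∀ U : X.Opens, AddSubgroup (P.sec U)} (hF : P.IsGoodFiltration F)

include hF

theorem PolyMap.HasOrderLE.d {V : X.Opens} {n M : ℕ} {A : P.PolyMap V n}
    (hA : A.HasOrderLE fun _ => M)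
    (hAF : ∀ (W : X.Opens) (hW : W ≤ V) (g : Fin n → Γ(X, W)), A.map W hW g ∈ F M W) :
    A.d.HasOrderLE fun _ => M := by
  intro W hW j g fs hfs
  simp only [PolyMap.d_map_eq]
  exact hochschild_update_mem_diffOps (F := fun n => F n W)
    (fun n f p hp => hF.commutator_mem n W f p hp) (fun f p hp => hF.commutator_zero W f p hp)
    (Nat.lt_succ_self M) (A.map W hW) (fun j g fs hfs => hA W hW j g fs hfs) (hAF W hW) j g fs hfs

variable (hcoord : ∀ w : X, ∃ (V : X.Opens) (_ : w ∈ V) (d : ℕ) (x : Fin d → Γ(X, V))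
  (y : Fin d → P.sec V), P.IsCoordinates F V x y)

include hcoord

theorem IsGoodFiltration.isComplex : P.IsComplex where
  d_mem U n A hA := by
    intro w hw
    obtain ⟨V, hwV, d, x, y, h⟩ := hcoord w
    obtain ⟨V', hU, -, hw', M, hord, hval⟩ := h.exists_bound hF hA hw hwV
    refine ⟨V', hU, hw', fun _ => M, ?_⟩
    rw [← PolyMap.d_restrict]
    exact hord.d hF hval
  d_add U n A _ B _ := PolyMap.d_add A B
  d_d U n A _ := PolyMap.d_d A

theorem IsGoodFiltration.vanishes [CharZero k] (n : ℕ) : P.CohomologySheafVanishes n := by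
  intro U A hA hd w hw
  obtain ⟨V, hwV, d, x, y, h⟩ := hcoord w
  obtain ⟨V', hU, hV, hw', M, hord, hval⟩ := h.exists_bound hF hA hw hwV
  have h' := h.restrict hF hV
  set x' : Fin d → Γ(X, V') := fun i => fres hV (x i)
  set y' : Fin d → P.sec V' := fun i => P.res hV (y i)
  set B := (A.restrict hU).homotopy M x' y' with hB
  have hBd : B.d = (-1 : ℤ) ^ (n + 1) • A.restrict hU := by
    refine PolyMap.eq_of_locally_eq fun W hW z hz => ?_
    obtain ⟨W', hW', hz', hspan⟩ := h'.span_eq_top W hW z hz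
    refine ⟨W', hW', hz', fun hW'V g => ?_⟩
    rw [PolyMap.d_map_eq]
    refine (h'.isLocalModel hF hW'V (hspan hW'V)).hochschild_coinducedLift M
      ((A.restrict hU).map W' hW'V) (fun g fs hfs => ?_) (fun g => hval W' hW'V g) (fun g => ?_) g
    · have := hord W' hW'V (Fin.last n) (Fin.snoc g 0) fs hfs
      simp only [Fin.update_snoc_last] at this
      exact this
    · rw [← PolyMap.d_map_eq, PolyMap.d_restrict, hd]
      rfl
  refine ⟨V', hU, hw', (-1 : ℤ) ^ (n + 1) • B, zsmul_mem
    (PolyMap.isPolyDiff_of_hasOrderLE (hord.homotopy M x' y')) _, ?_⟩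
  rw [PolyMap.d_zsmul, hBd, smul_smul, ← mul_pow]
  simp

omit hF in
theorem centralizer_eq_range (hι : ∀ U, Function.Injective (P.ι U)) (U : X.Opens) :
    P.centralizer U = (P.ι U).range := by
  ext p
  rw [mem_centralizer_iff]
  constructor
  · intro hp
    refine P.mem_range_ι_of_locally hι fun w hw => ?_
    obtain ⟨V, hwV, d, x, y, h⟩ := hcoord w
    obtain ⟨W, hW, hwW, f, hf⟩ := h.central (U ⊓ V) inf_le_right (P.res inf_le_left p)
      (fun i => (commutatorEnd_eq_zero_iff _ _).2 (hp _ _ _)) w ⟨hw, hwV⟩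
    exact ⟨W, hW.trans inf_le_left, hwW, f, by rw [hf, res_res]⟩
  · rintro ⟨g, rfl⟩ V h f
    rw [res_ι, ← map_mul, ← map_mul, mul_comm]

theorem IsGoodFiltration.isQuasiIso [CharZero k] (hι : ∀ U, Function.Injective (P.ι U)) :
    P.IsQuasiIso where
  isComplex := hF.isComplex hcoord
  injective := hι
  range_eq U := by
    rw [H0_eq_centralizer, centralizer_eq_range hcoord hι, RingHom.coe_range]
  vanishes := hF.vanishes hcoord

end AlgebraSheaf

/-! ### Coordinates on smooth schemes -/

section Geometry

open scoped KaehlerDifferential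

theorem exists_basis_kaehlerDifferential_of_isLocalization {k S : Type*} (T : Type*) [CommRing k]
    [CommRing S] [CommRing T] [Algebra k S] [Algebra k T] [Algebra S T] [IsScalarTower k S T]
    (M : Submonoid S) [IsLocalization M T] {σ : Type*} {x : σ → S} (b : Module.Basis σ S Ω[S⁄k])
    (hb : ∀ i, b i = KaehlerDifferential.D k S (x i)) :
    ∃ b' : Module.Basis σ T Ω[T⁄k],
      ∀ i, b' i = KaehlerDifferential.D k T (algebraMap S T (x i)) :=
  ⟨b.ofIsLocalizedModule T M (KaehlerDifferential.map k k S T), fun i => by simp [hb]⟩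

theorem exists_basis_kaehlerDifferential_of_isStandardSmooth (k S : Type*) [CommRing k]
    [CommRing S] [Algebra k S] [Algebra.IsStandardSmooth k S] :
    ∃ (d : ℕ) (x : Fin d → S) (b : Module.Basis (Fin d) S Ω[S⁄k]),
      ∀ i, b i = KaehlerDifferential.D k S (x i) := by
  obtain ⟨ι, σ, _, _, ⟨p⟩⟩ := Algebra.IsStandardSmooth.out (R := k) (S := S)
  let e := Finite.equivFin ((Set.range p.map)ᶜ : Set ι)
  exact ⟨_, fun i => p.val (e.symm i), p.basisKaehler.reindex e, fun i => by
    rw [Module.Basis.reindex_apply]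
    exact p.basisKaehler_apply _⟩

variable {k : Type u} [Field k] {X : Scheme.{u}} [X.Over (Spec (.of k))]

variable (k) in
/-- Functions on `V` whose differentials are a basis of the Kähler differentials of all stalks on
`V`, and of the algebras of functions on a basis of open sets. -/
structure IsCoordinateSystem (V : X.Opens) {d : ℕ} (x : Fin d → Γ(X, V)) : Prop where
  span_eq_top : ∀ W ≤ V, ∀ w ∈ W, ∃ W' ≤ W, w ∈ W' ∧ ∀ h : W' ≤ V,
    Submodule.span Γ(X, W')
      (Set.range fun i => KaehlerDifferential.D k Γ(X, W') (fres h (x i))) = ⊤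
  exists_basis : ∀ w (hw : w ∈ V), ∃ b : Module.Basis (Fin d) (X.presheaf.stalk w)
    Ω[X.presheaf.stalk w⁄k], ∀ i, b i = KaehlerDifferential.D k (X.presheaf.stalk w)
      ((X.presheaf.germ V w hw).hom (x i))

theorem germ_fres {V W : X.Opens} (h : W ≤ V) {w : X} (hw : w ∈ W) (f : Γ(X, V)) :
    (X.presheaf.germ W w hw).hom (fres h f) = (X.presheaf.germ V w (h hw)).hom f :=
  X.presheaf.germ_res_apply (homOfLE h) w hw f

theorem IsCoordinateSystem.restrict {V W : X.Opens} {d : ℕ} {x : Fin d → Γ(X, V)}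
    (h : IsCoordinateSystem k V x) (hW : W ≤ V) :
    IsCoordinateSystem k W (fun i => fres hW (x i)) where
  span_eq_top W' hW' w hw := by
    obtain ⟨W'', hW'', hw', hspan⟩ := h.span_eq_top W' (hW'.trans hW) w hw
    refine ⟨W'', hW'', hw', fun h' => ?_⟩
    simp only [fres_fres]
    exact hspan _
  exists_basis w hw := by
    obtain ⟨b, hb⟩ := h.exists_basis w (hW hw)
    exact ⟨b, fun i => by rw [hb, germ_fres]⟩

/-- Locally, the functions on `X` are a standard smooth algebra over `k` itself, because the only
nonempty open subset of `Spec k` is `Spec k`. -/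
theorem exists_isStandardSmooth_constants [Smooth (X ↘ Spec (.of k))] (w : X) :
    ∃ (V : X.Opens), IsAffineOpen V ∧ w ∈ V ∧ Algebra.IsStandardSmooth k Γ(X, V) := by
  obtain ⟨U, hU, V, hV, hw, e, hs⟩ := Smooth.exists_isStandardSmooth (X ↘ Spec (.of k)) w
  refine ⟨V, hV, hw, ?_⟩
  have hUtop : U = ⊤ := by
    have : Subsingleton (Spec (.of k)) := inferInstanceAs (Subsingleton (PrimeSpectrum k))
    ext z
    simp [Subsingleton.elim z ((X ↘ Spec (.of k)) w), show _ ∈ U from e hw]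
  subst hUtop
  have h1 : RingHom.IsStandardSmooth (Scheme.ΓSpecIso (.of k)).inv.hom :=
    (RingHom.IsStandardSmoothOfRelativeDimension.equiv
      (Scheme.ΓSpecIso (.of k)).symm.commRingCatIsoToRingEquiv).isStandardSmooth
  exact hs.comp h1

theorem exists_isCoordinateSystem [Smooth (X ↘ Spec (.of k))] (w : X) :
    ∃ (V : X.Opens) (_ : w ∈ V) (d : ℕ) (x : Fin d → Γ(X, V)), IsCoordinateSystem k V x := by
  obtain ⟨V, hV, hw, hs⟩ := exists_isStandardSmooth_constants (k := k) w
  obtain ⟨d, x, b, hb⟩ := exists_basis_kaehlerDifferential_of_isStandardSmooth k Γ(X, V)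
  refine ⟨V, hw, d, x, fun W hW z hz => ?_, fun z hz => ?_⟩
  · obtain ⟨f, hf, hzf⟩ := hV.exists_basicOpen_le ⟨z, hz⟩ (hW hz)
    refine ⟨X.basicOpen f, hf, hzf, fun h => ?_⟩
    let : Algebra Γ(X, V) Γ(X, X.basicOpen f) := (fres h).toAlgebra
    have : IsLocalization.Away f Γ(X, X.basicOpen f) := hV.isLocalization_basicOpen f
    have : IsScalarTower k Γ(X, V) Γ(X, X.basicOpen f) :=
      IsScalarTower.of_algebraMap_eq fun c => (fres_constants h c).symm
    obtain ⟨b', hb'⟩ := exists_basis_kaehlerDifferential_of_isLocalization Γ(X, X.basicOpen f)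
      (Submonoid.powers f) b hb
    rw [← b'.span_eq]
    congr 2
    ext i
    exact (hb' i).symm
  · let : Algebra Γ(X, V) (X.presheaf.stalk z) := (X.presheaf.germ V z hz).hom.toAlgebra
    have := hV.isLocalization_stalk ⟨z, hz⟩
    have : IsScalarTower k Γ(X, V) (X.presheaf.stalk z) :=
      IsScalarTower.of_algebraMap_eq fun c => by
        change (X.presheaf.germ ⊤ z trivial).hom (constants k X ⊤ c) =
          (X.presheaf.germ V z hz).hom (constants k X V c)
        rw [← fres_constants (le_top : V ≤ ⊤), germ_fres]
    exact exists_basis_kaehlerDifferential_of_isLocalization _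
      (hV.primeIdealOf ⟨z, hz⟩).asIdeal.primeCompl b hb

end Geometry

/-! ### Twisted differential operators -/

variable {k : Type u} [Field k] {X : Scheme.{u}} [X.Over (Spec (.of k))]

section Stalk

/-- Evaluation of derivations at an element extends to the symmetric algebra. -/
theorem symmetricAlgebra_ι_derivation_injective {k A : Type*} [CommRing k] [CommRing A]
    [Algebra k A] : Function.Injective (SymmetricAlgebra.ι A (Derivation k A A)) := by
  intro τ τ' h
  ext a
  let ev : Derivation k A A →ₗ[A] A :=
    { toFun := fun τ => τ a
      map_add' := fun _ _ => rfl
      map_smul' := fun _ _ => rfl }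
  have := congrArg (SymmetricAlgebra.lift ev) h
  rwa [SymmetricAlgebra.lift_ι_apply, SymmetricAlgebra.lift_ι_apply] at this

/-- The derivations dual to a basis `D (x i)` of the Kähler differentials. -/
theorem exists_dual_derivation {k A : Type*} [CommRing k] [CommRing A] [Algebra k A] {d : ℕ}
    {x : Fin d → A} (b : Module.Basis (Fin d) A (KaehlerDifferential k A))
    (hb : ∀ i, b i = KaehlerDifferential.D k A (x i)) (j : Fin d) :
    ∃ τ : Derivation k A A, ∀ i, τ (x i) = if i = j then 1 else 0 := by
  refine ⟨(b.coord j).compDer (KaehlerDifferential.D k A), fun i => ?_⟩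
  change b.coord j (KaehlerDifferential.D k A (x i)) = _
  rw [← hb, Module.Basis.coord_apply, Module.Basis.repr_self,
    Finsupp.single_apply]

theorem derivation_eq_sum {k A : Type*} [CommRing k] [CommRing A] [Algebra k A] {d : ℕ}
    {x : Fin d → A}
    (hx : Submodule.span A (Set.range fun i => KaehlerDifferential.D k A (x i)) = ⊤)
    {δ : Fin d → Derivation k A A} (hδ : ∀ i j, δ j (x i) = if i = j then 1 else 0)
    (τ : Derivation k A A) : τ = ∑ j, τ (x j) • δ j := by
  refine sub_eq_zero.1 (derivation_eq_zero hx _ fun i => ?_)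
  rw [Derivation.sub_apply, ← Derivation.coeFnAddMonoidHom_apply (∑ j, _), map_sum,
    Finset.sum_apply]
  simp [hδ]

end Stalk

namespace TDO

variable (D : TDO k X)

theorem fil_monotone (U : X.Opens) : Monotone fun n => D.fil n U :=
  monotone_nat_of_le_succ fun n => D.fil_mono n U

variable {D}

theorem symbol_sub_eq {n : ℕ} {w : X} {U : X.Opens} (hw : w ∈ U) (p q : D.fil n U) :
    D.symbol n w U hw (p - q) = D.symbol n w U hw p - D.symbol n w U hw q := map_sub _ _ _

/-- Two sections of `Dⁿ⁺¹` with the same symbols differ by a section of `Dⁿ`. -/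
theorem sub_mem_of_symbol_eq {n : ℕ} {U : X.Opens} {p q : D.sec U} (hp : p ∈ D.fil (n + 1) U)
    (hq : q ∈ D.fil (n + 1) U)
    (h : ∀ w (hw : w ∈ U), D.symbol (n + 1) w U hw ⟨p, hp⟩ = D.symbol (n + 1) w U hw ⟨q, hq⟩) :
    p - q ∈ D.fil n U := by
  refine D.fil_local n U _ fun w hw => ?_
  have := (D.symbol_eq_zero_succ n w U hw (⟨p, hp⟩ - ⟨q, hq⟩)).1 (by
    rw [symbol_sub_eq, h w hw, sub_self])
  exact this

/-- Commutators lower the filtration, because the associated graded algebra is commutative. -/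
theorem commutator_mem {m n : ℕ} {U : X.Opens} {p q : D.sec U} (hp : p ∈ D.fil m U)
    (hq : q ∈ D.fil n U) {l : ℕ} (hl : m + n = l + 1) : p * q - q * p ∈ D.fil l U := by
  have key (a b : ℕ) (ha : a = l + 1) (hb : b = l + 1) (r s : D.sec U) (hr : r ∈ D.fil a U)
      (hs : s ∈ D.fil b U)
      (h : ∀ w (hw : w ∈ U), D.symbol a w U hw ⟨r, hr⟩ = D.symbol b w U hw ⟨s, hs⟩) :
      r - s ∈ D.fil l U := by
    subst ha hb
    exact sub_mem_of_symbol_eq hr hs h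
  refine key (m + n) (n + m) hl (by omega) _ _ (D.fil_mul m n U p hp q hq)
    (D.fil_mul n m U q hq p hp) fun w hw => ?_
  rw [D.symbol_mul m n w U hw ⟨p, hp⟩ ⟨q, hq⟩, D.symbol_mul n m w U hw ⟨q, hq⟩ ⟨p, hp⟩, mul_comm]

theorem ι_injective (U : X.Opens) : Function.Injective (D.ι U) := by
  rw [injective_iff_map_eq_zero]
  intro f hf
  refine TopCat.Presheaf.section_ext X.sheaf U f 0 fun w hw => ?_
  have h1 := D.symbol_ι w U hw f
  have h2 : (⟨D.ι U f, D.ι_mem U f⟩ : D.fil 0 U) = 0 := Subtype.ext hf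
  rw [h2, map_zero] at h1
  exact ((SymmetricAlgebra.algebraMap_eq_zero_iff _ _).1 h1.symm).trans
    (map_zero (X.presheaf.germ U w hw).hom).symm

/-- Sections of `D⁰` locally are functions. -/
theorem exists_ι_eq {U : X.Opens} {p : D.sec U} (hp : p ∈ D.fil 0 U) {w : X} (hw : w ∈ U) :
    ∃ (V : X.Opens) (h : V ≤ U), w ∈ V ∧ D.res h p ∈ Set.range (D.ι V) := by
  have h1 := D.symbol_mem 0 w U hw ⟨p, hp⟩
  rw [symDegree, pow_zero, Submodule.mem_one] at h1
  obtain ⟨a, ha⟩ := h1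
  obtain ⟨V, hV, hwV, f, rfl⟩ := X.presheaf.exists_le_germ_eq a hw
  have h2 := D.symbol_eq_zero_zero w V hwV (⟨D.res hV p, D.fil_res 0 U V hV p hp⟩ -
    ⟨D.ι V f, D.ι_mem V f⟩)
  rw [symbol_sub_eq, D.symbol_res 0 w U V hV hwV ⟨p, hp⟩, D.symbol_ι, ← ha] at h2
  obtain ⟨W, hW, hwW, h3⟩ := h2.1 (sub_self _)
  refine ⟨W, hW.trans hV, hwW, fres hW f, ?_⟩
  have h4 : D.res hW (D.res hV p) - D.res hW (D.ι V f) = 0 := by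
    rw [← map_sub]
    exact h3
  rw [AlgebraSheaf.res_res, AlgebraSheaf.res_ι] at h4
  exact (sub_eq_zero.1 h4).symm

variable (D) in
theorem isGoodFiltration : D.IsGoodFiltration D.fil where
  res_mem n _ _ h p hp := D.fil_res n _ _ h p hp
  mem_of_locally := D.fil_local
  mono := D.fil_monotone
  mul_mem := D.fil_mul
  exhaustive := D.fil_exhaustive
  ι_mem := D.ι_mem
  commutator_mem n U f p hp := by
    rw [AlgebraSheaf.commutatorEnd_eq]
    exact commutator_mem hp (D.ι_mem U f) rfl
  commutator_zero U f p hp := by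
    refine D.eq_of_locally_eq fun w hw => ?_
    obtain ⟨V, hV, hwV, g, hg⟩ := exists_ι_eq hp hw
    refine ⟨V, hV, hwV, ?_⟩
    rw [AlgebraSheaf.res_commutator, ← hg, AlgebraSheaf.commutatorEnd_eq, ← map_mul, ← map_mul,
      mul_comm, sub_self, map_zero]

/-- The symbol of a section of `D¹`, on germs of functions, computes commutators. -/
theorem symbol_one_apply {U : X.Opens} {p : D.sec U} (hp : p ∈ D.fil 1 U) {w : X} (hw : w ∈ U)
    {τ : tangentStalk k w} (hτ : D.symbol 1 w U hw ⟨p, hp⟩ = SymmetricAlgebra.ι _ _ τ)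
    (f : Γ(X, U)) : ∃ g : Γ(X, U), D.ι U g = commutatorEnd (D.sec U) f p ∧
      (X.presheaf.germ U w hw).hom g = τ ((X.presheaf.germ U w hw).hom f) := by
  obtain ⟨τ', h1, h2⟩ := D.symbol_one w U hw ⟨p, hp⟩
  obtain rfl : τ = τ' := symmetricAlgebra_ι_derivation_injective (hτ.symm.trans h1)
  obtain ⟨g, hg, hτg⟩ := h2 U le_rfl hw f
  rw [D.res_self] at hg
  exact ⟨g, hg.trans (AlgebraSheaf.commutatorEnd_eq _ _ _).symm, hτg.symm⟩

theorem exists_symbol_one_eq {U : X.Opens} {p : D.sec U} (hp : p ∈ D.fil 1 U) {w : X}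
    (hw : w ∈ U) : ∃ τ : tangentStalk k w, D.symbol 1 w U hw ⟨p, hp⟩ = SymmetricAlgebra.ι _ _ τ :=
  let ⟨τ, h, _⟩ := D.symbol_one w U hw ⟨p, hp⟩
  ⟨τ, h⟩

/-- Finitely many equalities of germs at a point hold on a common neighbourhood. -/
theorem exists_germ_eq_nhds {V : X.Opens} {w : X} (hw : w ∈ V) {σ : Type*} (s : Finset σ)
    (f g : σ → Γ(X, V))
    (h : ∀ i ∈ s, (X.presheaf.germ V w hw).hom (f i) = (X.presheaf.germ V w hw).hom (g i)) :
    ∃ (W : X.Opens) (hW : W ≤ V), w ∈ W ∧ ∀ i ∈ s, fres hW (f i) = fres hW (g i) := by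
  classical
  induction s using Finset.induction with
  | empty => exact ⟨V, le_rfl, hw, by simp⟩
  | insert i s hi ih =>
    obtain ⟨W, hW, hwW, ih⟩ := ih fun j hj => h j (Finset.mem_insert_of_mem hj)
    obtain ⟨W', hwW', i₁, i₂, heq⟩ := X.presheaf.germ_eq w hw hw (f i) (g i)
      (h i (Finset.mem_insert_self i s))
    refine ⟨W ⊓ W', inf_le_left.trans hW, ⟨hwW, hwW'⟩, fun j hj => ?_⟩
    rcases Finset.mem_insert.1 hj with rfl | hj
    · have h1 : fres i₁.le (f j) = fres i₁.le (g j) := heq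
      rw [← fres_fres i₁.le inf_le_right, h1, fres_fres]
    · rw [← fres_fres hW inf_le_left, ih j hj, fres_fres]

/-- Locally, there are sections of `D¹` that are dual to a system of coordinates. -/
theorem exists_dual_sections {V : X.Opens} {d : ℕ} {x : Fin d → Γ(X, V)}
    (h : IsCoordinateSystem k V x) {w : X} (hw : w ∈ V) :
    ∃ (W : X.Opens) (hW : W ≤ V) (_ : w ∈ W) (y : Fin d → D.sec W), (∀ i, y i ∈ D.fil 1 W) ∧
      ∀ i j, commutatorEnd (D.sec W) (fres hW (x i)) (y j) = if i = j then 1 else 0 := by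
  obtain ⟨b, hb⟩ := h.exists_basis w hw
  choose τ hτ using exists_dual_derivation b hb
  have hdeg (j : Fin d) : SymmetricAlgebra.ι _ _ (τ j) ∈ symDegree k w 1 := by
    rw [symDegree, pow_one]
    exact ⟨_, rfl⟩
  choose U hwU p hp using fun j => D.symbol_surjective 1 w _ (hdeg j)
  let W₁ : X.Opens := V ⊓ ⨅ j, U j
  have hW₁V : W₁ ≤ V := inf_le_left
  have hW₁U (j : Fin d) : W₁ ≤ U j := inf_le_right.trans (iInf_le _ _)
  have hwW₁ : w ∈ W₁ := ⟨hw, by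
    rw [Opens.coe_iInf]
    exact Set.mem_iInter.2 hwU⟩
  let y₁ (j : Fin d) : D.sec W₁ := D.res (hW₁U j) (p j)
  have hy₁ (j : Fin d) : y₁ j ∈ D.fil 1 W₁ := D.fil_res 1 _ _ _ _ (p j).2
  have hs (j : Fin d) : D.symbol 1 w W₁ hwW₁ ⟨y₁ j, hy₁ j⟩ = SymmetricAlgebra.ι _ _ (τ j) :=
    (D.symbol_res 1 w (U j) W₁ (hW₁U j) hwW₁ (p j)).trans (hp j)
  choose g hg hgτ using fun i j => symbol_one_apply (hy₁ j) hwW₁ (hs j) (fres hW₁V (x i))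
  obtain ⟨W, hW, hwW, hgW⟩ := exists_germ_eq_nhds hwW₁ Finset.univ
    (fun ij : Fin d × Fin d => g ij.1 ij.2) (fun ij => if ij.1 = ij.2 then 1 else 0) (by
      rintro ⟨i, j⟩ -
      refine (hgτ i j).trans ?_
      rw [germ_fres, hτ]
      change _ = (X.presheaf.germ W₁ w hwW₁).hom (if i = j then 1 else 0)
      split_ifs <;> simp)
  refine ⟨W, hW.trans hW₁V, hwW, fun j => D.res hW (y₁ j), fun j => D.fil_res 1 _ _ hW _ (hy₁ j),
    fun i j => ?_⟩
  have h1 := hgW (i, j) (Finset.mem_univ _)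
  rw [← fres_fres hW₁V hW, ← AlgebraSheaf.res_commutator, ← hg, AlgebraSheaf.res_ι, h1]
  change D.ι W (fres hW (if i = j then 1 else 0)) = _
  split_ifs <;> simp

/-- Two elements of the symmetric algebra at `w` are symbols of sections on a common
neighbourhood. -/
theorem exists_symbol_eq_and_symbol_eq {n : ℕ} {w : X} {U : X.Opens} (hw : w ∈ U)
    {a b : symStalk k w}
    (ha : a ∈ symDegree k w (n + 1)) (hb : b ∈ symDegree k w 1) :
    ∃ (W : X.Opens) (_ : W ≤ U) (hwW : w ∈ W) (q : D.fil (n + 1) W) (r : D.fil 1 W),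
      D.symbol (n + 1) w W hwW q = a ∧ D.symbol 1 w W hwW r = b := by
  obtain ⟨U₁, hw₁, q, hq⟩ := D.symbol_surjective (n + 1) w a ha
  obtain ⟨U₂, hw₂, r, hr⟩ := D.symbol_surjective 1 w b hb
  refine ⟨U ⊓ (U₁ ⊓ U₂), inf_le_left, ⟨hw, hw₁, hw₂⟩,
    ⟨D.res (inf_le_right.trans inf_le_left) q, D.fil_res _ _ _ _ _ q.2⟩,
    ⟨D.res (inf_le_right.trans inf_le_right) r, D.fil_res _ _ _ _ _ r.2⟩, ?_, ?_⟩
  · rw [← hq]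
    exact D.symbol_res (n + 1) w U₁ _ _ _ q
  · rw [← hr]
    exact D.symbol_res 1 w U₂ _ _ _ r

section Euler

variable {V : X.Opens} {d : ℕ} {x : Fin d → Γ(X, V)} {y : Fin d → D.sec V}

/-- The Euler operator `∑ [p, xᵢ] yᵢ`, which acts on symbols of degree `n` as multiplication
by `n`. -/
def euler (x : Fin d → Γ(X, V)) (y : Fin d → D.sec V) (p : D.sec V) : D.sec V :=
  ∑ i, commutatorEnd (D.sec V) (x i) p * y i

theorem euler_sub (p q : D.sec V) : euler x y (p - q) = euler x y p - euler x y q := by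
  simp [euler, sub_mul]

theorem res_euler {W : X.Opens} (hW : W ≤ V) (p : D.sec V) : D.res hW (euler x y p) =
    euler (fun i => fres hW (x i)) (fun i => D.res hW (y i)) (D.res hW p) := by
  simp [euler, AlgebraSheaf.res_commutator]

variable (hx : IsCoordinateSystem k V x) (hy : ∀ i, y i ∈ D.fil 1 V)
  (hxy : ∀ i j, commutatorEnd (D.sec V) (x i) (y j) = if i = j then 1 else 0)

include hy

theorem euler_mem {n : ℕ} {p : D.sec V} (hp : p ∈ D.fil (n + 1) V) :
    euler x y p ∈ D.fil (n + 1) V :=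
  sum_mem fun i _ => D.fil_mul n 1 V _ (D.isGoodFiltration.commutator_mem n V _ p hp) _ (hy i)

/-- Modulo the lower step of the filtration, the Euler operator is a derivation. -/
theorem euler_mul_sub_mem {n : ℕ} {q r : D.sec V} (hq : q ∈ D.fil (n + 1) V)
    (hr : r ∈ D.fil 1 V) (hqe : euler x y q - (n + 1) • q ∈ D.fil n V)
    (hre : euler x y r - r ∈ D.fil 0 V) :
    euler x y (q * r) - (n + 2) • (q * r) ∈ D.fil (n + 1) V := by
  have h1 : euler x y (q * r) - (n + 2) • (q * r) = q * (euler x y r - r) +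
      (euler x y q - (n + 1) • q) * r +
      ∑ i, commutatorEnd (D.sec V) (x i) q * (r * y i - y i * r) := by
    simp only [euler, mul_sub, sub_mul, Finset.mul_sum, Finset.sum_mul, smul_mul_assoc,
      Finset.sum_sub_distrib]
    have h2 : ∑ i, commutatorEnd (D.sec V) (x i) (q * r) * y i =
        ∑ i, q * (commutatorEnd (D.sec V) (x i) r * y i) +
          ∑ i, commutatorEnd (D.sec V) (x i) q * (r * y i) := by
      rw [← Finset.sum_add_distrib]
      refine Finset.sum_congr rfl fun i _ => ?_
      simp only [AlgebraSheaf.commutatorEnd_eq]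
      noncomm_ring
    rw [h2]
    simp only [mul_assoc, add_smul, two_smul, one_smul]
    abel
  rw [h1]
  refine add_mem (add_mem ?_ ?_) (sum_mem fun i _ => ?_)
  · exact D.fil_mul (n + 1) 0 V q hq _ hre
  · exact D.fil_mul n 1 V _ hqe r hr
  · exact D.fil_mul n 1 V _ (D.isGoodFiltration.commutator_mem n V _ q hq) _
      (commutator_mem hr (hy i) rfl)

include hx hxy

/-- The Euler operator fixes symbols of degree one, because a derivation `τ` is `∑ τ(xᵢ) δᵢ` for the
derivations `δᵢ` dual to the coordinates. -/
theorem euler_sub_mem_zero {r : D.sec V} (hr : r ∈ D.fil 1 V) : euler x y r - r ∈ D.fil 0 V := by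
  refine sub_mem_of_symbol_eq (euler_mem hy hr) hr fun w hw => ?_
  obtain ⟨b, hb⟩ := hx.exists_basis w hw
  obtain ⟨τ, hτ⟩ := exists_symbol_one_eq hr hw
  choose δ hδ using fun j => exists_symbol_one_eq (hy j) hw
  choose g hg hgτ using fun i => symbol_one_apply hr hw hτ (x i)
  have hδx (i j : Fin d) : δ j ((X.presheaf.germ V w hw).hom (x i)) = if i = j then 1 else 0 := by
    obtain ⟨e, he, heδ⟩ := symbol_one_apply (hy j) hw (hδ j) (x i)
    rw [← heδ]
    have : e = if i = j then 1 else 0 := ι_injective V (by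
      rw [he, hxy]
      split_ifs <;> simp)
    rw [this]
    split_ifs <;> simp
  have hτ' : τ = ∑ j, τ ((X.presheaf.germ V w hw).hom (x j)) • δ j := by
    refine derivation_eq_sum ?_ hδx τ
    rw [← b.span_eq]
    congr 2
    ext i
    exact (hb i).symm
  have h0 : (⟨euler x y r, euler_mem hy hr⟩ : D.fil 1 V) =
      ∑ i, ⟨D.ι V (g i) * y i, D.fil_mul 0 1 V _ (D.ι_mem V _) _ (hy i)⟩ := by
    refine Subtype.ext ?_
    rw [AddSubgroup.val_finsetSum]
    simp only [euler, hg]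
  refine Eq.trans ?_ hτ.symm
  refine (congrArg (D.symbol 1 w V hw) h0).trans ?_
  rw [map_sum, hτ', map_sum]
  refine Finset.sum_congr rfl fun i _ => ?_
  refine (D.symbol_mul 0 1 w V hw ⟨_, D.ι_mem V (g i)⟩ ⟨y i, hy i⟩).trans ?_
  rw [D.symbol_ι, hδ, hgτ, map_smul, Algebra.smul_def]

/-- The Euler operator acts on symbols of degree `n + 1` as multiplication by `n + 1`, because the
symmetric algebra is generated in degree one. -/
theorem euler_sub_mem {n : ℕ} {p : D.sec V} (hp : p ∈ D.fil (n + 1) V) :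
    euler x y p - (n + 1) • p ∈ D.fil n V := by
  induction n generalizing V with
  | zero => simpa using euler_sub_mem_zero hx hy hxy hp
  | succ n ih =>
    have restr {W : X.Opens} (hW : W ≤ V) :
        IsCoordinateSystem k W (fun i => fres hW (x i)) ∧ (∀ i, D.res hW (y i) ∈ D.fil 1 W) ∧
        ∀ i j, commutatorEnd (D.sec W) (fres hW (x i)) (D.res hW (y j)) =
          if i = j then 1 else 0 := by
      refine ⟨hx.restrict hW, fun i => D.fil_res 1 _ _ hW _ (hy i), fun i j => ?_⟩
      rw [← AlgebraSheaf.res_commutator, hxy]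
      split_ifs <;> simp
    refine D.fil_local (n + 1) V _ fun w hw => ?_
    -- Every symbol of degree `n + 2` at `w` comes from a section that satisfies the claim.
    have key : ∀ t ∈ symDegree k w (n + 2), ∃ (W : X.Opens) (hW : W ≤ V) (hwW : w ∈ W)
        (q : D.fil (n + 2) W), D.symbol (n + 2) w W hwW q = t ∧
        euler (fun i => fres hW (x i)) (fun i => D.res hW (y i)) q - (n + 2) • q.1 ∈
          D.fil (n + 1) W := by
      intro t ht
      rw [symDegree, pow_succ] at ht
      refine Submodule.mul_induction_on ht (fun a ha b hb => ?_) fun s t hs ht => ?_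
      · obtain ⟨W, hW, hwW, q, r, rfl, rfl⟩ := exists_symbol_eq_and_symbol_eq (D := D) hw ha
          (by rwa [symDegree, pow_one])
        obtain ⟨h1, h2, h3⟩ := restr hW
        exact ⟨W, hW, hwW, ⟨q * r, D.fil_mul (n + 1) 1 W _ q.2 _ r.2⟩,
          D.symbol_mul (n + 1) 1 w W hwW q r,
          euler_mul_sub_mem h2 q.2 r.2 (ih h1 h2 h3 q.2) (euler_sub_mem_zero h1 h2 h3 r.2)⟩
      · obtain ⟨W₁, hW₁, hwW₁, q₁, rfl, h₁⟩ := hs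
        obtain ⟨W₂, hW₂, hwW₂, q₂, rfl, h₂⟩ := ht
        have l₁ : W₁ ⊓ W₂ ≤ W₁ := inf_le_left
        have l₂ : W₁ ⊓ W₂ ≤ W₂ := inf_le_right
        refine ⟨W₁ ⊓ W₂, l₁.trans hW₁, ⟨hwW₁, hwW₂⟩,
          ⟨D.res l₁ q₁, D.fil_res _ _ _ _ _ q₁.2⟩ + ⟨D.res l₂ q₂, D.fil_res _ _ _ _ _ q₂.2⟩,
          ?_, ?_⟩
        · rw [map_add]
          exact congrArg₂ (· + ·) (D.symbol_res (n + 2) w W₁ _ l₁ ⟨hwW₁, hwW₂⟩ q₁)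
            (D.symbol_res (n + 2) w W₂ _ l₂ ⟨hwW₁, hwW₂⟩ q₂)
        · have h₁' := D.fil_res _ _ _ l₁ _ h₁
          have h₂' := D.fil_res _ _ _ l₂ _ h₂
          simp only [map_sub, res_euler, map_nsmul, fres_fres, AlgebraSheaf.res_res] at h₁' h₂'
          have := add_mem h₁' h₂'
          convert! this using 1
          simp only [AddSubgroup.coe_add, euler, map_add, add_mul, Finset.sum_add_distrib, smul_add]
          abel
    obtain ⟨W, hW, hwW, q, hq, hqe⟩ := key _ (D.symbol_mem (n + 2) w V hw ⟨p, hp⟩)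
    rw [← D.symbol_res (n + 2) w V W hW hwW ⟨p, hp⟩] at hq
    have h1 := (D.symbol_eq_zero_succ (n + 1) w W hwW (⟨D.res hW p, D.fil_res _ _ _ _ _ hp⟩ - q)).1
      (by rw [symbol_sub_eq, hq, sub_self])
    obtain ⟨W', hW', hwW', h1⟩ := h1
    refine ⟨W', hW'.trans hW, hwW', ?_⟩
    obtain ⟨-, h2, -⟩ := restr (hW'.trans hW)
    have h3 := D.fil_res _ _ _ hW' _ hqe
    have h4 := sub_mem (euler_mem (x := fun i => fres (hW'.trans hW) (x i)) h2 h1)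
      (nsmul_mem h1 (n + 2))
    rw [AddSubgroup.coe_sub, map_sub, euler_sub] at h4
    simp only [map_sub, res_euler, map_nsmul, fres_fres, AlgebraSheaf.res_res] at h3 h4 ⊢
    have := add_mem h3 h4
    convert! this using 1
    rw [smul_sub]
    abel

end Euler

/-- A section of `D` that commutes with a system of coordinates locally is a function: the Euler
operator kills it, so that in characteristic zero its symbol in any positive degree vanishes. -/
theorem exists_ι_eq_of_commutator_eq_zero [CharZero k] {V : X.Opens} {d : ℕ} {x : Fin d → Γ(X, V)}
    {y : Fin d → D.sec V} (hx : IsCoordinateSystem k V x) (hy : ∀ i, y i ∈ D.fil 1 V)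
    (hxy : ∀ i j, commutatorEnd (D.sec V) (x i) (y j) = if i = j then 1 else 0) {p : D.sec V}
    (hp : ∀ i, commutatorEnd (D.sec V) (x i) p = 0) {n : ℕ} (hpn : p ∈ D.fil n V) {w : X}
    (hw : w ∈ V) : ∃ (W : X.Opens) (h : W ≤ V), w ∈ W ∧ D.res h p ∈ Set.range (D.ι W) := by
  induction n with
  | zero => exact exists_ι_eq hpn hw
  | succ n ih =>
    refine ih ?_
    have h1 := euler_sub_mem hx hy hxy hpn
    have h2 : euler x y p = 0 := by simp [euler, hp]
    rw [h2, zero_sub, neg_mem_iff] at h1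
    have h3 := D.isGoodFiltration.smul_mem (algebraMap k Γ(X, V) ((n + 1 : ℕ) : k)⁻¹) h1
    rwa [algebraMap_smul, ← Nat.cast_smul_eq_nsmul k, smul_smul, inv_mul_cancel₀, one_smul] at h3
    exact Nat.cast_ne_zero.2 (Nat.succ_ne_zero n)

variable (D) in
theorem exists_isCoordinates [CharZero k] [Smooth (X ↘ Spec (.of k))] (w : X) :
    ∃ (V : X.Opens) (_ : w ∈ V) (d : ℕ) (x : Fin d → Γ(X, V)) (y : Fin d → D.sec V),
      D.IsCoordinates D.fil V x y := by
  obtain ⟨V₀, hw₀, d, x₀, hx₀⟩ := exists_isCoordinateSystem (k := k) w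
  obtain ⟨V, hV, hw, y, hy, hxy⟩ := exists_dual_sections (D := D) hx₀ hw₀
  have hx := hx₀.restrict hV
  refine ⟨V, hw, d, fun i => fres hV (x₀ i), y, hy, hxy, fun W hW p hp z hz => ?_, hx.span_eq_top⟩
  obtain ⟨Z, hZ, hzZ, n, hn⟩ := D.fil_exhaustive W p z hz
  have hZV := hZ.trans hW
  obtain ⟨Z', hZ', hz', h⟩ := exists_ι_eq_of_commutator_eq_zero (y := fun i => D.res hZV (y i))
    (hx.restrict hZV) (fun i => D.fil_res 1 _ _ hZV _ (hy i))
    (fun i j => by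
      rw [← AlgebraSheaf.res_commutator, hxy]
      split_ifs <;> simp) (p := D.res hZ p) (fun i => by
      rw [← fres_fres hW hZ, ← AlgebraSheaf.res_commutator, hp, map_zero]) hn hzZ
  refine ⟨Z', hZ'.trans hZ, hz', ?_⟩
  rwa [AlgebraSheaf.res_res] at h

end TDO

namespace AlgebraSheaf

variable {P : AlgebraSheaf k X}

/-- The filtration of the opposite algebras defined by a filtration of `P`. -/
def opFil (F : ℕ → ∀ U : X.Opens, AddSubgroup (P.sec U)) (n : ℕ) (U : X.Opens) :
    AddSubgroup (P.op.sec U) :=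
  (F n U).comap ((MulOpposite.opAddEquiv (α := P.sec U)).symm.toAddMonoidHom.comp
    (P.opSec U).symm.toAddEquiv.toAddMonoidHom)

theorem op_commutatorEnd {U : X.Opens} (f : Γ(X, U)) (p : P.sec U) :
    commutatorEnd (P.op.sec U) f (P.opSec U (MulOpposite.op p)) =
      P.opSec U (MulOpposite.op (-commutatorEnd (P.sec U) f p)) := by
  rw [commutatorEnd_eq, commutatorEnd_eq, op_ι, neg_sub, MulOpposite.op_sub, map_sub,
    MulOpposite.op_mul, MulOpposite.op_mul, map_mul, map_mul]

theorem op_res {V W : X.Opens} (h : W ≤ V) (p : P.sec V) :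
    P.op.res h (P.opSec V (MulOpposite.op p)) = P.opSec W (MulOpposite.op (P.res h p)) := rfl

theorem opSec_mem_opFil {F : ℕ → ∀ U : X.Opens, AddSubgroup (P.sec U)} {n : ℕ} {U : X.Opens}
    {p : P.sec U} : P.opSec U (MulOpposite.op p) ∈ opFil F n U ↔ p ∈ F n U := Iff.rfl

theorem exists_eq_opSec {U : X.Opens} (p : P.op.sec U) :
    ∃ q : P.sec U, p = P.opSec U (MulOpposite.op q) :=
  ⟨MulOpposite.unop ((P.opSec U).symm p), rfl⟩

theorem opSec_op_injective (U : X.Opens) :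
    Function.Injective fun p : P.sec U => P.opSec U (MulOpposite.op p) :=
  (P.opSec U).injective.comp MulOpposite.op_injective

theorem op_commutatorEnd_eq_zero {U : X.Opens} (f : Γ(X, U)) (p : P.sec U) :
    commutatorEnd (P.op.sec U) f (P.opSec U (MulOpposite.op p)) = 0 ↔
      commutatorEnd (P.sec U) f p = 0 := by
  rw [op_commutatorEnd, ← neg_eq_zero (a := commutatorEnd _ _ _)]
  exact (opSec_op_injective U).eq_iff (b := 0)

theorem IsGoodFiltration.op {F : ℕ → ∀ U : X.Opens, AddSubgroup (P.sec U)}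
    (hF : P.IsGoodFiltration F) : P.op.IsGoodFiltration (opFil F) where
  res_mem n V W h p hp := hF.res_mem n h _ hp
  mem_of_locally n U p hp := hF.mem_of_locally n U _ hp
  mono U _ _ hmn p hp := hF.mono U hmn hp
  mul_mem m n U p hp q hq := by
    have := hF.mul_mem n m U _ hq _ hp
    rw [add_comm] at this
    exact this
  exhaustive U p := hF.exhaustive U _
  ι_mem := hF.ι_mem
  commutator_mem n U f p hp := by
    obtain ⟨q, rfl⟩ := exists_eq_opSec p
    rw [op_commutatorEnd]
    exact neg_mem (hF.commutator_mem n U f q hp)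
  commutator_zero U f p hp := by
    obtain ⟨q, rfl⟩ := exists_eq_opSec p
    exact (op_commutatorEnd_eq_zero f q).2 (hF.commutator_zero U f q hp)

/-- Commutators change sign in the opposite algebra, and so do the dual sections. -/
theorem IsCoordinates.op {F : ℕ → ∀ U : X.Opens, AddSubgroup (P.sec U)} {V : X.Opens} {d : ℕ}
    {x : Fin d → Γ(X, V)} {y : Fin d → P.sec V} (h : P.IsCoordinates F V x y) :
    P.op.IsCoordinates (opFil F) V x (fun i => P.opSec V (MulOpposite.op (-y i))) where
  y_mem i := opSec_mem_opFil.2 (neg_mem (h.y_mem i))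
  commutator_y i j := by
    rw [op_commutatorEnd, map_neg, neg_neg, h.commutator_y]
    split_ifs <;> rfl
  central W hW p hp w hw := by
    obtain ⟨q, rfl⟩ := exists_eq_opSec p
    obtain ⟨W', hW', hw', f, hf⟩ := h.central W hW q
      (fun i => (op_commutatorEnd_eq_zero _ _).1 (hp i)) w hw
    exact ⟨W', hW', hw', f, by rw [op_res, op_ι, hf]⟩
  span_eq_top := h.span_eq_top

theorem op_ι_injective (hι : ∀ U, Function.Injective (P.ι U)) (U : X.Opens) :
    Function.Injective (P.op.ι U) :=
  (opSec_op_injective U).comp (hι U)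

theorem opSec_op_mem_H0_iff {U : X.Opens} (p : P.sec U) :
    P.opSec U (MulOpposite.op p) ∈ P.op.H0 U ↔ p ∈ P.centralizer U := by
  rw [mem_H0_iff, mem_centralizer_iff]
  refine forall₃_congr fun V h f => ?_
  rw [op_res, op_ι, ← map_mul, ← map_mul, ← MulOpposite.op_mul, ← MulOpposite.op_mul]
  exact (opSec_op_injective V).eq_iff.trans eq_comm

end AlgebraSheaf

end TwistedDiff

/-- Let `X` be a smooth scheme over a field `k` of characteristic zero and `D` a sheaf of twisted
differential operators on `X`. Then `𝒪_X → D` is a quasi-isomorphism (of algebras) from `𝒪_X` to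
`Diff(𝒪_X^•, D)`; the zeroth cohomology is the centralizer of `𝒪_X` in `D`, which is the subalgebra
`𝒪_X`, and the higher cohomology sheaves vanish. The same holds for `Diff(𝒪_X^•, D^op)^op`, whose
zeroth cohomology is again the centralizer of `𝒪_X` in `D = (D^op)^op`. -/
theorem proposition3p1 (k : Type u) [Field k] [CharZero k] (X : Scheme.{u}) [X.Over (Spec (.of k))]
    [Smooth (X ↘ Spec (.of k))] (D : TwistedDiff.TDO k X) :
    (D.toAlgebraSheaf.IsQuasiIso ∧
      ∀ U : X.Opens, D.toAlgebraSheaf.H0 U = D.toAlgebraSheaf.centralizer U ∧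
        D.toAlgebraSheaf.centralizer U = (D.toAlgebraSheaf.ι U).range) ∧
    (D.toAlgebraSheaf.op.IsQuasiIso ∧
      ∀ (U : X.Opens) (p : D.toAlgebraSheaf.sec U),
        D.toAlgebraSheaf.opSec U (MulOpposite.op p) ∈ D.toAlgebraSheaf.op.H0 U ↔
          p ∈ D.toAlgebraSheaf.centralizer U) := by
  have hι := TwistedDiff.TDO.ι_injective (D := D)
  refine ⟨⟨D.isGoodFiltration.isQuasiIso D.exists_isCoordinates hι, fun U =>
    ⟨TwistedDiff.AlgebraSheaf.H0_eq_centralizer U,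
      TwistedDiff.AlgebraSheaf.centralizer_eq_range D.exists_isCoordinates hι U⟩⟩,
    D.isGoodFiltration.op.isQuasiIso (fun w => ?_) (TwistedDiff.AlgebraSheaf.op_ι_injective hι),
    fun U p => TwistedDiff.AlgebraSheaf.opSec_op_mem_H0_iff p⟩
  obtain ⟨V, hw, d, x, y, h⟩ := D.exists_isCoordinates w
  exact ⟨V, hw, d, x, _, h.op⟩
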